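/- Let $m$ be a positive even integer. For $\tau$ in the upper half-plane $\mathbb H$ and $z\in\mathbb C$ write $q=e^{2\pi i\tau}$, $\zeta=e^{2\pi i z}$ and $$\vartheta(z;\tau)=\sum_{\nu\in\frac12+\mathbb Z}e^{\pi i\nu^2\tau+2\pi i\nu\left(z+\frac12\right)},\qquad \varphi(z;\tau)=\left(\frac{\vartheta(z+\frac12;\tau)}{\vartheta(z;\tau)}\right)^m .$$ Let $\chi_r(\tau)$, $r\in\mathbb Z$, be the Fourier coefficients of $\varphi$ in the strip $0<\operatorname{Im} z<\operatorname{Im}\tau$, and let $D_{2j}(\tau)$, $0\le j\le m/2$, be the coefficient of $(2\pi i z)^{-2j}$ in the Laurent expansion of $z\mapsto\varphi(z;\tau)$ at $z=0$; that is, $$\varphi(z;\tau)=\sum_{r\in\mathbb Z}\chi_r(\tau)\zeta^r\quad(0<\operatorname{Im} z<\operatorname{Im}\tau),\qquad \varphi(z;\tau)=\sum_{j=0}^{m/2}\frac{D_{2j}(\tau)}{(2\pi i z)^{2j}}+O(z^2)\quad(z\to0),$$ and both expansions hold for every $\tau\in\mathbb H$. Let $B_n$ be the Bernoulli numbers, $\frac{t}{e^t-1}=\sum_{n\ge0}B_n\frac{t^n}{n!}$,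 and for $j\ge1$ let $$E_{2j}(\tau)=1-\frac{4j}{B_{2j}}\sum_{\ell\ge1}\sigma_{2j-1}(\ell)q^\ell,\qquad \sigma_k(\ell)=\sum_{d\mid\ell}d^k .$$ Then for every $\tau\in\mathbb H$ $$\chi_r(\tau)=\frac1{1-q^r}\sum_{j=1}^{m/2}\frac{r^{2j-1}}{(2j-1)!}D_{2j}(\tau)\quad(r\in\mathbb Z,\ r\ne0),\qquad \chi_0(\tau)=D_0(\tau)+\sum_{j=1}^{m/2}\frac{B_{2j}}{(2j)!}D_{2j}(\tau)E_{2j}(\tau).$$ Moreover, for each $0\le j\le m/2$ the function $D_{2j}$ is a weakly holomorphic modular form of weight $-2j$ on $\Gamma_0(2)$ with Nebentypus character $\psi(\gamma)=(-1)^{mc/4}$, $\gamma=\begin{pmatrix}a&b\\c&d\end{pmatrix}$: it is holomorphic on $\mathbb H$, satisfies $$D_{2j}\left(\frac{a\tau+b}{c\tau+d}\right)=\psi(\gamma)(c\tau+d)^{-2j}D_{2j}(\tau)\qquad(\gamma\in\Gamma_0(2)),$$ and is meromorphic at all cusps. -/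

import Mathlib

open UpperHalfPlane ModularForm MatrixGroups Filter Topology Asymptotics
open scoped Manifold Real Nat

noncomputable section

namespace KacWakimoto

/-- Jacobi's theta function `ϑ(z; τ) = ∑_{ν ∈ 1/2 + ℤ} exp(π i ν² τ + 2 π i ν (z + 1/2))`,
with `ν = n + 1/2`. -/
def theta (z : ℂ) (τ : ℍ) : ℂ :=
  ∑' n : ℤ, Complex.exp (π * Complex.I * ((n : ℂ) + 1 / 2) ^ 2 * (τ : ℂ)
    + 2 * π * Complex.I * ((n : ℂ) + 1 / 2) * (z + 1 / 2))

/-- `φ(z; τ) = (ϑ(z + 1/2; τ) / ϑ(z; τ)) ^ m`. -/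
def phi (m : ℕ) (z : ℂ) (τ : ℍ) : ℂ :=
  (theta (z + 1 / 2) τ / theta z τ) ^ m

/-- The nome `q = exp(2 π i τ)`. -/
def nome (τ : ℍ) : ℂ := Complex.exp (2 * π * Complex.I * (τ : ℂ))

/-- `ζ = exp(2 π i z)`. -/
def zeta (z : ℂ) : ℂ := Complex.exp (2 * π * Complex.I * z)

/-- The `r`-th Fourier coefficient (in `z`) of `φ(z; τ)` in the strip `0 < Im z < Im τ`, computed
on the middle line `z = x + i Im τ / 2`, `0 ≤ x ≤ 1`, of the strip. -/
def chi (m : ℕ) (r : ℤ) (τ : ℍ) : ℂ :=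
  ∫ x in (0 : ℝ)..1, phi m ((x : ℂ) + Complex.I * ((τ.im / 2 : ℝ) : ℂ)) τ
    * zeta ((x : ℂ) + Complex.I * ((τ.im / 2 : ℝ) : ℂ)) ^ (-r)

/-- The coefficient of `(z - c) ^ n` in the Laurent expansion of `f` at an isolated singularity
`c`: the value of `(2 π i)⁻¹ ∮ f(z) (z - c) ^ (-n - 1) dz` over circles `|z - c| = ρ` with `ρ > 0`
small (the integral does not depend on `ρ` once `ρ` is small, and the limit is this value). -/
def laurentCoeff (f : ℂ → ℂ) (c : ℂ) (n : ℤ) : ℂ :=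
  limUnder (𝓝[>] (0 : ℝ)) fun ρ : ℝ =>
    (2 * π * Complex.I)⁻¹ * ∮ z in C(c, ρ), f z * (z - c) ^ (-n - 1)

/-- `D_k(τ)`, the coefficient of `(2 π i z) ^ (-k)` in the Laurent expansion of `z ↦ φ(z; τ)`
at `z = 0`. -/
def D (m k : ℕ) (τ : ℍ) : ℂ :=
  (2 * π * Complex.I) ^ k * laurentCoeff (fun z => phi m z τ) 0 (-(k : ℤ))

/-- The Eisenstein series `E_{2j}(τ) = 1 - (4j / B_{2j}) ∑_{ℓ ≥ 1} σ_{2j-1}(ℓ) q ^ ℓ`, `j ≥ 1`. -/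
def eisenstein (j : ℕ) (τ : ℍ) : ℂ :=
  1 - 4 * (j : ℂ) / (bernoulli (2 * j) : ℂ)
    * ∑' l : ℕ, (ArithmeticFunction.sigma (2 * j - 1) (l + 1) : ℂ) * nome τ ^ (l + 1)

/-- The character `ψ(γ) = (-1) ^ (m c / 4)` of `Γ₀(2)`, for `γ = (a b; c d)` and `m` even
(so that `m c` is divisible by `4`). -/
def psi (m : ℕ) (hm : Even m) : CongruenceSubgroup.Gamma0 2 →* ℂ where
  toFun γ := (-1 : ℂ) ^ ((m : ℤ) * (γ : SL(2, ℤ)) 1 0 / 4)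
  map_one' := by simp
  map_mul' γ δ := by
    obtain ⟨n, rfl⟩ := hm
    obtain ⟨γ, hγ⟩ := γ
    obtain ⟨δ, hδ⟩ := δ
    rw [CongruenceSubgroup.Gamma0_mem, ZMod.intCast_zmod_eq_zero_iff_dvd] at hγ hδ
    obtain ⟨c, hc⟩ := hγ
    obtain ⟨c', hc'⟩ := hδ
    have h1 := Matrix.SpecialLinearGroup.det_coe γ
    have h2 := Matrix.SpecialLinearGroup.det_coe δ
    rw [Matrix.det_fin_two] at h1 h2
    push_cast at hc hc'
    have hd : ∃ d, γ.1 1 1 = 2 * d + 1 := by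
      rcases Int.even_or_odd' (γ.1 1 1) with ⟨d, h | h⟩
      · exfalso
        rw [h, hc] at h1
        have : (2 : ℤ) ∣ 1 := ⟨γ.1 0 0 * d - γ.1 0 1 * c, by linarith⟩
        omega
      · exact ⟨d, h⟩
    have ha : ∃ a, δ.1 0 0 = 2 * a + 1 := by
      rcases Int.even_or_odd' (δ.1 0 0) with ⟨d, h | h⟩
      · exfalso
        rw [h, hc'] at h2
        have : (2 : ℤ) ∣ 1 := ⟨d * δ.1 1 1 - δ.1 0 1 * c', by linarith⟩
        omega
      · exact ⟨d, h⟩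
    obtain ⟨d, hd⟩ := hd
    obtain ⟨a, ha⟩ := ha
    have hmul : (γ * δ).1 1 0 = γ.1 1 0 * δ.1 0 0 + γ.1 1 1 * δ.1 1 0 := by
      simp [Matrix.mul_apply, Fin.sum_univ_two]
    change (-1 : ℂ) ^ (((n + n : ℕ) : ℤ) * (γ * δ).1 1 0 / 4)
      = (-1 : ℂ) ^ (((n + n : ℕ) : ℤ) * γ.1 1 0 / 4) * (-1 : ℂ) ^ (((n + n : ℕ) : ℤ) * δ.1 1 0 / 4)
    rw [hmul, hc, hc', hd, ha]
    have e1 : ((n + n : ℕ) : ℤ) * (2 * c) / 4 = n * c := by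
      push_cast
      exact Int.ediv_eq_of_eq_mul_right (by norm_num) (by ring)
    have e2 : ((n + n : ℕ) : ℤ) * (2 * c') / 4 = n * c' := by
      push_cast
      exact Int.ediv_eq_of_eq_mul_right (by norm_num) (by ring)
    have e3 : ((n + n : ℕ) : ℤ) * (2 * c * (2 * a + 1) + (2 * d + 1) * (2 * c')) / 4
        = n * c + n * c' + 2 * (n * (c * a + d * c')) := by
      push_cast
      exact Int.ediv_eq_of_eq_mul_right (by norm_num) (by ring)
    rw [e1, e2, e3, zpow_add₀ (by norm_num), zpow_add₀ (by norm_num), zpow_mul (-1 : ℂ) 2]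
    simp

/-- Weakly holomorphic modular forms of weight `k` on `Γ₀(N)` with character `χ`: holomorphic on
the upper half plane, `f ∣[k] γ = χ(γ) f` for `γ ∈ Γ₀(N)`, and meromorphic at every cusp. The cusps
are the images of `∞` under `SL₂(ℤ)`; a pole of order at most `M` (in the variable `q`) of
`f ∣[k] γ` at `∞` means that `q ^ M (f ∣[k] γ)` is bounded as `Im τ → ∞`. -/
structure IsWeaklyHolomorphicModularForm (N : ℕ) (k : ℤ) (χ : CongruenceSubgroup.Gamma0 N →* ℂ)
    (f : ℍ → ℂ) : Prop where
  holomorphic : MDifferentiable 𝓘(ℂ) 𝓘(ℂ) f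
  slash_eq : ∀ γ : CongruenceSubgroup.Gamma0 N, ∀ τ : ℍ, (f ∣[k] (γ : SL(2, ℤ))) τ = χ γ * f τ
  meromorphic_at_cusps : ∀ γ : SL(2, ℤ), ∃ M : ℕ,
    IsBoundedAtImInfty fun τ : ℍ => nome τ ^ M * (f ∣[k] γ) τ

end KacWakimoto

end

/-! ### Liouville's theorem in the strip |Im z| < Im τ -/

namespace KacWakimoto

/-! For fixed τ and even m, φ is elliptic in z for the lattice ℤ + ℤτ, and its only poles are the
lattice points. It is therefore determined, up to a constant, by its even principal part at 0. For
odd k = 2j - 1, the function P_k = `ellipticSum k τ` is elliptic with principal part (2πiz)^(-2j) at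
0. Its Fourier coefficients in 0 < Im z < Im τ are r^k / (k! (1 - q^r)), and its constant term at 0
is -B_{2j} E_{2j} / (2j)!. Hence φ - ∑ D_{2j} P_{2j-1} is elliptic without poles, so it is constant
(`eq_of_periodic_of_tendsto`), and evaluating at 0 gives `phi_eq_add_sum_ellipticSum`. Both formulas
for χ_r are read off from it.

That ϑ vanishes in the strip only at integers comes from an Appell sum A with a simple pole at 0:
exp(πiz) A(z) ϑ(z) is elliptic without poles, hence equal to a constant, and this constant is
nonzero (`exp_mul_appell_mul_theta`, `deriv_theta_ne_zero`).

For modularity, φ is placed in a triple of functions, the m-th powers of the three even theta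
functions divided by ϑ. The generators T and S permute the triple up to constants, and S also
replaces z by τz (`phiGen_T_smul`, `phiGen_S_smul`); this scaling produces the weight -2j. The
character is computed on the generators T, S T² S, -1 of Γ₀(2) (`Gamma0_two_le`). Holomorphy and
growth at the cusps both follow from writing the Laurent coefficient as an integral over a fixed
circle. Growth is needed only at i∞, but for all three quotients, because SL₂(ℤ) permutes them. -/

theorem isOpen_setOf_forall_ne_intCast : IsOpen {z : ℂ | ∀ n : ℤ, z ≠ n} := by
  have h : {z : ℂ | ∀ n : ℤ, z ≠ n} = (Set.range ((↑) : ℤ → ℂ))ᶜ := by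
    ext z; simp [eq_comm]
  rw [h]
  exact Complex.isClosed_range_intCast.isOpen_compl

theorem eventually_ne_intCast_nhdsNE_zero : ∀ᶠ z : ℂ in 𝓝[≠] (0 : ℂ), ∀ n : ℤ, z ≠ n := by
  have h : Metric.ball (0 : ℂ) 1 ∈ 𝓝[≠] (0 : ℂ) :=
    mem_nhdsWithin_of_mem_nhds (Metric.ball_mem_nhds _ one_pos)
  filter_upwards [h, self_mem_nhdsWithin] with z hz hz0 n hn
  rw [mem_ball_zero_iff, hn, Complex.norm_intCast] at hz
  have : n = 0 := by
    have : |n| < 1 := by exact_mod_cast hz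
    exact Int.abs_lt_one_iff.1 this
  exact hz0 (by simp [hn, this])

/-- A function on the strip `|Im z| < Im τ` with periods `1` and `τ`, holomorphic outside the
integers and with a finite limit at `0`, is constant. -/
theorem eq_of_periodic_of_tendsto {τ : ℂ} (hτ : 0 < τ.im) {F : ℂ → ℂ} {c : ℂ}
    (hd : ∀ z : ℂ, |z.im| < τ.im → (∀ n : ℤ, z ≠ n) → DifferentiableAt ℂ F z)
    (h1 : ∀ z, F (z + 1) = F z)
    (h2 : ∀ z : ℂ, z.im < 0 → -τ.im < z.im → F (z + τ) = F z)
    (hc : Tendsto F (𝓝[≠] 0) (𝓝 c)) {z : ℂ} (hz : |z.im| < τ.im) (hzn : ∀ n : ℤ, z ≠ n) :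
    F z = c := by
  classical
  -- G fills in the limit c at the integers. It is holomorphic on the whole strip: by the removable
  -- singularity theorem at 0, and by the period 1 at the other integers.
  let G : ℂ → ℂ := fun z => if ∃ n : ℤ, z = n then c else F z
  have hGF : ∀ z : ℂ, (∀ n : ℤ, z ≠ n) → G z = F z := fun z hz => if_neg (by simpa using hz)
  have hGint : ∀ n : ℤ, G n = c := fun n => if_pos ⟨n, rfl⟩
  have hG1 : ∀ z, G (z + 1) = G z := by
    intro z
    by_cases h : ∃ n : ℤ, z = n
    · obtain ⟨n, rfl⟩ := h
      have := hGint (n + 1)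
      push_cast at this
      rw [this, hGint]
    · push Not at h
      rw [hGF z h, hGF, h1]
      intro n hn
      exact h (n - 1) (by push_cast; rw [← hn]; ring)
  have hGz : ∀ (n : ℤ) z, G (z + n) = G z := by
    intro n z
    have hp : Function.Periodic G 1 := hG1
    simpa using hp.int_mul n z
  have hGd0 : DifferentiableAt ℂ G 0 := by
    refine (Complex.analyticAt_of_differentiable_on_punctured_nhds_of_continuousAt ?_
      ?_).differentiableAt
    · have hs : {z : ℂ | |z.im| < τ.im} ∈ 𝓝[≠] (0 : ℂ) := by
        refine mem_nhdsWithin_of_mem_nhds (IsOpen.mem_nhds ?_ (by simpa using hτ))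
        exact isOpen_lt (by fun_prop) continuous_const
      filter_upwards [hs, eventually_ne_intCast_nhdsNE_zero] with w hw hwn
      refine (hd w hw hwn).congr_of_eventuallyEq ?_
      filter_upwards [isOpen_setOf_forall_ne_intCast.mem_nhds hwn] with v hv using hGF v hv
    · rw [continuousAt_iff_punctured_nhds]
      have : G 0 = c := by simpa using hGint 0
      rw [this]
      refine hc.congr' ?_
      filter_upwards [eventually_ne_intCast_nhdsNE_zero] with w hw using (hGF w hw).symm
  have hGd : ∀ w : ℂ, |w.im| < τ.im → DifferentiableAt ℂ G w := by
    intro w hw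
    by_cases h : ∃ n : ℤ, w = n
    · obtain ⟨n, rfl⟩ := h
      have e : G = fun v => G (v + ((-n : ℤ) : ℂ)) := funext fun v => (hGz (-n) v).symm
      rw [e]
      have h0 : DifferentiableAt ℂ G ((n : ℂ) + ((-n : ℤ) : ℂ)) := by simpa using hGd0
      exact h0.comp (n : ℂ) (differentiableAt_id.add_const _)
    · push Not at h
      refine (hd w hw h).congr_of_eventuallyEq ?_
      filter_upwards [isOpen_setOf_forall_ne_intCast.mem_nhds h] with v hv using hGF v hv
  let U : Set ℂ := {w : ℂ | |w.im| < τ.im}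
  have hUo : IsOpen U := isOpen_lt (by fun_prop) continuous_const
  have hUc : IsPreconnected U := by
    have : U = Complex.imLm ⁻¹' (Metric.ball 0 τ.im) := by ext w; simp [U]
    rw [this]
    exact ((convex_ball (0 : ℝ) τ.im).linear_preimage Complex.imLm).isPreconnected
  have hGU : DifferentiableOn ℂ G U := fun w hw => (hGd w hw).differentiableWithinAt
  -- Translations by 1 and at most one translation by ±τ bring each point of the strip into this
  -- rectangle. The maximum of |G| on it is thus a maximum over the open strip, and the maximum
  -- modulus principle applies.
  have hK : IsCompact (Set.Icc (0 : ℝ) 1 ×ℂ Set.Icc (-(τ.im / 2)) (τ.im / 2)) :=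
    isCompact_Icc.reProdIm isCompact_Icc
  have hKU : Set.Icc (0 : ℝ) 1 ×ℂ Set.Icc (-(τ.im / 2)) (τ.im / 2) ⊆ U := by
    intro w hw
    rw [Complex.mem_reProdIm] at hw
    obtain ⟨_, hw1, hw2⟩ := hw
    change |w.im| < τ.im
    exact abs_lt.2 ⟨by linarith, by linarith⟩
  obtain ⟨w, hwK, hw⟩ := hK.exists_isMaxOn
    ⟨0, by rw [Complex.mem_reProdIm]; constructor <;> constructor <;> simp <;> linarith⟩
    (hGU.continuousOn.norm.mono hKU)
  have hsmall : ∀ v : ℂ, |v.im| ≤ τ.im / 2 → ‖G v‖ ≤ ‖G w‖ := by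
    intro v hv
    rw [← hGz (-⌊v.re⌋) v, Int.cast_neg, ← sub_eq_add_neg]
    refine hw (show _ ∈ _ from ?_)
    rw [Complex.mem_reProdIm]
    obtain ⟨hv1, hv2⟩ := abs_le.1 hv
    simp only [Complex.sub_re, Complex.intCast_re, Complex.sub_im, Complex.intCast_im, sub_zero,
      Set.mem_Icc]
    exact ⟨⟨by linarith [Int.floor_le v.re], by linarith [Int.lt_floor_add_one v.re]⟩, hv1, hv2⟩
  have hne : ∀ v : ℂ, v.im ≠ 0 → ∀ n : ℤ, v ≠ n := by
    rintro v hv n rfl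
    simp at hv
  have hmax : IsMaxOn (norm ∘ G) U w := by
    intro v hv
    change ‖G v‖ ≤ ‖G w‖
    obtain ⟨hv1, hv2⟩ := abs_lt.1 (show |v.im| < τ.im from hv)
    rcases le_or_gt |v.im| (τ.im / 2) with h | h
    · exact hsmall v h
    · rcases lt_abs.1 h with h | h
      · have e : G v = G (v - τ) := by
          rw [hGF v (hne v (by linarith)), hGF (v - τ) (hne _ (by simp; linarith)),
            ← h2 (v - τ) (by simp; linarith) (by simp; linarith), sub_add_cancel]
        rw [e]
        refine hsmall _ (abs_le.2 ⟨?_, ?_⟩) <;> simp <;> linarith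
      · have e : G v = G (v + τ) := by
          rw [hGF v (hne v (by linarith)), hGF (v + τ) (hne _ (by simp; linarith)),
            h2 v (by linarith) (by linarith)]
        rw [e]
        refine hsmall _ (abs_le.2 ⟨?_, ?_⟩) <;> simp <;> linarith
  have hconst := Complex.eqOn_of_isPreconnected_of_isMaxOn_norm hUc hUo hGU (hKU hwK) hmax
  have hz' : G z = G w := hconst hz
  have h0' : G 0 = G w := hconst (show (0 : ℂ) ∈ U by simpa [U] using hτ)
  have h0 : G 0 = c := by simpa using hGint 0
  rw [← hGF z hzn, hz', ← h0', h0]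

/-! ### Fourier coefficients on a horizontal line -/

theorem zeta_ne_zero (z : ℂ) : zeta z ≠ 0 := Complex.exp_ne_zero _

theorem zeta_zpow (z : ℂ) (r : ℤ) : zeta z ^ r = Complex.exp (2 * π * Complex.I * (r * z)) := by
  rw [zeta, ← Complex.exp_int_mul]; congr 1; ring

theorem norm_zeta (z : ℂ) : ‖zeta z‖ = Real.exp (-(2 * π * z.im)) := by
  rw [zeta, Complex.norm_exp]; simp

/-- The coefficients of a Fourier series converging on a horizontal line are given by the usual
integrals. -/
theorem integral_mul_zeta_zpow_of_hasSum {a : ℤ → ℂ} {f : ℂ → ℂ} {y : ℝ}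
    (h : ∀ x : ℝ, HasSum (fun r : ℤ => a r * zeta ((x : ℂ) + Complex.I * (y : ℂ)) ^ r)
      (f ((x : ℂ) + Complex.I * (y : ℂ)))) (r : ℤ) :
    ∫ x in (0 : ℝ)..1, f ((x : ℂ) + Complex.I * (y : ℂ))
      * zeta ((x : ℂ) + Complex.I * (y : ℂ)) ^ (-r) = a r := by
  have hnorm : ∀ x : ℝ, ‖zeta ((x : ℂ) + Complex.I * (y : ℂ))‖ = Real.exp (-(2 * π * y)) := by
    intro x; rw [norm_zeta]; simp
  have hterm : ∀ (s : ℤ) (x : ℝ), a s * zeta ((x : ℂ) + Complex.I * (y : ℂ)) ^ s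
      * zeta ((x : ℂ) + Complex.I * (y : ℂ)) ^ (-r)
      = a s * zeta ((x : ℂ) + Complex.I * (y : ℂ)) ^ (s - r) := by
    intro s x
    rw [mul_assoc, ← zpow_add₀ (zeta_ne_zero _), sub_eq_add_neg]
  have hcont : ∀ s : ℤ, Continuous fun x : ℝ => zeta ((x : ℂ) + Complex.I * (y : ℂ)) ^ s := by
    intro s
    simp_rw [zeta_zpow]
    fun_prop
  -- On the line |ζ| is constant, so the norms of the terms do not depend on x and themselves serve
  -- as a summable majorant.
  have hsum := intervalIntegral.hasSum_integral_of_dominated_convergence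
    (μ := MeasureTheory.volume) (a := 0) (b := 1)
    (F := fun (s : ℤ) (x : ℝ) => a s * zeta ((x : ℂ) + Complex.I * (y : ℂ)) ^ s
      * zeta ((x : ℂ) + Complex.I * (y : ℂ)) ^ (-r))
    (f := fun x : ℝ => f ((x : ℂ) + Complex.I * (y : ℂ))
      * zeta ((x : ℂ) + Complex.I * (y : ℂ)) ^ (-r))
    (fun s _ => ‖a s‖ * Real.exp (-(2 * π * y)) ^ (s - r))
    (fun s => by
      have : Continuous fun x : ℝ => a s * zeta ((x : ℂ) + Complex.I * (y : ℂ)) ^ s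
          * zeta ((x : ℂ) + Complex.I * (y : ℂ)) ^ (-r) :=
        (continuous_const.mul (hcont s)).mul (hcont (-r))
      exact this.aestronglyMeasurable)
    (fun s => by
      filter_upwards with x _
      rw [hterm, norm_mul, norm_zpow, hnorm])
    (by
      filter_upwards with x _
      have := ((h x).mul_right (zeta ((x : ℂ) + Complex.I * (y : ℂ)) ^ (-r))).summable.norm
      refine this.congr fun s => ?_
      rw [hterm, norm_mul, norm_zpow, hnorm])
    (by simp)
    (by
      filter_upwards with x _
      exact (h x).mul_right _)
  refine hsum.unique ?_
  have hval : ∀ s : ℤ, ∫ x in (0 : ℝ)..1, a s * zeta ((x : ℂ) + Complex.I * (y : ℂ)) ^ s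
      * zeta ((x : ℂ) + Complex.I * (y : ℂ)) ^ (-r) = if s = r then a r else 0 := by
    intro s
    simp_rw [hterm]
    rw [intervalIntegral.integral_const_mul]
    split_ifs with hs
    · subst hs
      simp
    · have hk : ((s - r : ℤ) : ℂ) ≠ 0 := by exact_mod_cast sub_ne_zero.2 hs
      have hne : 2 * π * Complex.I * ((s - r : ℤ) : ℂ) ≠ 0 :=
        mul_ne_zero Complex.two_pi_I_ne_zero hk
      have e : ∀ x : ℝ, zeta ((x : ℂ) + Complex.I * (y : ℂ)) ^ (s - r)
          = Complex.exp (2 * π * Complex.I * ((s - r : ℤ) : ℂ) * (Complex.I * y))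
            * Complex.exp (2 * π * Complex.I * ((s - r : ℤ) : ℂ) * x) := by
        intro x
        rw [zeta_zpow, ← Complex.exp_add]
        congr 1; ring
      simp_rw [e]
      rw [intervalIntegral.integral_const_mul, integral_exp_mul_complex hne]
      have : Complex.exp (2 * π * Complex.I * ((s - r : ℤ) : ℂ) * (1 : ℝ)) = 1 := by
        rw [Complex.exp_eq_one_iff]
        exact ⟨s - r, by push_cast; ring⟩
      rw [this]
      simp
  simp_rw [hval]
  exact hasSum_ite_eq r (a r)

/-! ### Laurent coefficients as Taylor coefficients -/

section Laurent

variable {f g : ℂ → ℂ} {m i : ℕ} {n : ℤ} {R ρ : ℝ}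

/-- The integrand is g(z) / z^(i+1), so this is Cauchy's formula for the i-th Taylor coefficient of
g. The value does not depend on ρ, so the limit defining `laurentCoeff` is that of an eventually
constant function. -/
theorem circleIntegral_eq_iteratedDeriv (hg : DifferentiableOn ℂ g (Metric.ball 0 R))
    (hf : ∀ z ∈ Metric.ball (0 : ℂ) R, z ≠ 0 → f z = g z / z ^ m) (hn : n = i - m)
    (h0 : 0 < ρ) (hR : ρ < R) :
    (2 * π * Complex.I)⁻¹ * ∮ z in C(0, ρ), f z * (z - 0) ^ (-n - 1)
      = iteratedDeriv i g 0 / (i ! : ℕ) := by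
  have key := DifferentiableOn.circleIntegral_one_div_sub_center_pow_smul h0 i
    (hg.mono (Metric.closedBall_subset_ball hR))
  have : ∮ z in C(0, ρ), f z * (z - 0) ^ (-n - 1)
      = ∮ z in C(0, ρ), (1 / (z - 0) ^ (i + 1)) • g z := by
    refine circleIntegral.integral_congr h0.le fun z hz => ?_
    have hz0 : z ≠ 0 := by
      rintro rfl
      simp at hz
      linarith
    have hzR : z ∈ Metric.ball (0 : ℂ) R := by
      rw [mem_sphere_zero_iff_norm] at hz
      rw [mem_ball_zero_iff, hz]
      exact hR
    simp only [sub_zero, smul_eq_mul]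
    rw [hf z hzR hz0, hn, show (-((i : ℤ) - m) - 1 : ℤ) = (m : ℤ) - ((i + 1 : ℕ) : ℤ) by
      push_cast; ring, zpow_sub₀ hz0, zpow_natCast, zpow_natCast]
    field_simp
  rw [this, key, smul_eq_mul]
  have := Complex.two_pi_I_ne_zero
  field_simp

theorem laurentCoeff_eq_iteratedDeriv (h0 : 0 < R) (hg : DifferentiableOn ℂ g (Metric.ball 0 R))
    (hf : ∀ z ∈ Metric.ball (0 : ℂ) R, z ≠ 0 → f z = g z / z ^ m) (hn : n = i - m) :
    laurentCoeff f 0 n = iteratedDeriv i g 0 / (i ! : ℕ) := by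
  refine Tendsto.limUnder_eq (tendsto_const_nhds.congr' ?_)
  filter_upwards [Ioo_mem_nhdsGT h0] with ρ hρ
  exact (circleIntegral_eq_iteratedDeriv hg hf hn hρ.1 hρ.2).symm

end Laurent

/-! ### Circle integrals depending on a parameter -/

/-- Differentiation under the integral sign. Cauchy's estimate on discs of radius r bounds the
derivative in w by M / r, where M bounds F over a compact neighbourhood times the circle. -/
theorem differentiableOn_circleIntegral {U : Set ℂ} (hU : IsOpen U) {F : ℂ → ℂ → ℂ} {ρ : ℝ}
    (hρ : 0 ≤ ρ) (hc : ContinuousOn (Function.uncurry F) (U ×ˢ Metric.sphere 0 ρ))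
    (hd : ∀ z ∈ Metric.sphere (0 : ℂ) ρ, DifferentiableOn ℂ (fun w => F w z) U) :
    DifferentiableOn ℂ (fun w => ∮ z in C(0, ρ), F w z) U := by
  intro w₀ hw₀
  obtain ⟨ε, hε, hball⟩ := Metric.isOpen_iff.1 hU w₀ hw₀
  set r := ε / 3 with hr
  have hr0 : 0 < r := by positivity
  have hcl : ∀ w ∈ Metric.ball w₀ r, Metric.closedBall w r ⊆ Metric.closedBall w₀ (2 * r) := by
    intro w hw
    exact Metric.closedBall_subset_closedBall' (by rw [Metric.mem_ball] at hw; linarith)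
  have hclU : Metric.closedBall w₀ (2 * r) ⊆ U :=
    (Metric.closedBall_subset_ball (by linarith)).trans hball
  have hs : ∀ t : ℝ, circleMap 0 ρ t ∈ Metric.sphere (0 : ℂ) ρ := circleMap_mem_sphere 0 hρ
  obtain ⟨M, hM⟩ := ((isCompact_closedBall w₀ (2 * r)).prod
    (isCompact_sphere (0 : ℂ) ρ)).exists_bound_of_continuousOn
      (hc.mono (Set.prod_mono_left hclU))
  have hcont : ∀ w ∈ U, Continuous fun t : ℝ => F w (circleMap 0 ρ t) := by
    intro w hw
    have : Continuous fun t : ℝ => (w, circleMap 0 ρ t) := by fun_prop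
    exact hc.comp_continuous this fun t => ⟨hw, hs t⟩
  have hcd : Continuous fun t : ℝ => deriv (circleMap 0 ρ) t := by
    simp only [deriv_circleMap]; fun_prop
  have hdiff : ∀ t : ℝ, ∀ w ∈ U, DifferentiableAt ℂ (fun w => F w (circleMap 0 ρ t)) w :=
    fun t w hw => (hd _ (hs t)).differentiableAt (hU.mem_nhds hw)
  have key := intervalIntegral.hasDerivAt_integral_of_dominated_loc_of_deriv_le
    (𝕜 := ℂ) (μ := MeasureTheory.volume) (a := 0) (b := 2 * π) (x₀ := w₀)
    (F := fun w t => deriv (circleMap 0 ρ) t • F w (circleMap 0 ρ t))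
    (F' := fun w t => deriv (circleMap 0 ρ) t • deriv (fun w => F w (circleMap 0 ρ t)) w)
    (bound := fun _ => ρ * (M / r)) (Metric.ball_mem_nhds w₀ hr0)
    (by
      filter_upwards [hU.mem_nhds hw₀] with w hw
      exact (hcd.smul (hcont w hw)).aestronglyMeasurable)
    ((hcd.smul (hcont w₀ hw₀)).intervalIntegrable _ _)
    (by
      refine hcd.aestronglyMeasurable.smul ?_
      -- The derivative in w is measurable in t as the pointwise limit of difference quotients along
      -- w₀ + r/(k+1), each continuous in t.
      have hseq : ∀ k : ℕ, w₀ + ((r / (k + 1) : ℝ) : ℂ) ∈ U := by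
        intro k
        apply hclU
        rw [Metric.mem_closedBall, dist_eq_norm, add_sub_cancel_left, Complex.norm_real,
          Real.norm_of_nonneg (by positivity)]
        have : r / ((k : ℝ) + 1) ≤ r := div_le_self hr0.le (by linarith [k.cast_nonneg (α := ℝ)])
        linarith
      have hlim : Tendsto (fun k : ℕ => w₀ + ((r / (k + 1) : ℝ) : ℂ)) atTop (𝓝[≠] w₀) := by
        refine tendsto_nhdsWithin_iff.2 ⟨?_, ?_⟩
        · have h1 : Tendsto (fun k : ℕ => r / ((k : ℝ) + 1)) atTop (𝓝 0) := by
            have := tendsto_one_div_add_atTop_nhds_zero_nat.const_mul r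
            simpa only [mul_one_div, mul_zero] using this
          have h2 := (Complex.continuous_ofReal.tendsto 0).comp h1
          simpa using h2.const_add w₀
        · filter_upwards with k
          simp only [Set.mem_compl_iff, Set.mem_singleton_iff, add_eq_left, Complex.ofReal_eq_zero]
          positivity
      refine aestronglyMeasurable_of_tendsto_ae (u := atTop)
        (f := fun (k : ℕ) (t : ℝ) => slope (fun w => F w (circleMap 0 ρ t)) w₀
          (w₀ + ((r / (k + 1) : ℝ) : ℂ))) (fun k => ?_) ?_
      · simp only [slope_def_field]
        exact (((hcont _ (hseq k)).sub (hcont _ hw₀)).div_const _).aestronglyMeasurable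
      · filter_upwards with t
        exact (hasDerivAt_iff_tendsto_slope.1 (hdiff t w₀ hw₀).hasDerivAt).comp hlim)
    (by
      filter_upwards with t _ w hw
      rw [norm_smul]
      have e : ‖deriv (circleMap 0 ρ) t‖ = ρ := by simp [abs_of_nonneg hρ]
      rw [e]
      refine mul_le_mul_of_nonneg_left ?_ hρ
      refine Complex.norm_deriv_le_of_forall_mem_sphere_norm_le hr0 ?_ fun v hv => ?_
      · refine DifferentiableOn.diffContOnCl ?_
        rw [closure_ball w hr0.ne']
        exact (hd _ (hs t)).mono ((hcl w hw).trans hclU)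
      · exact hM (v, circleMap 0 ρ t) ⟨hcl w hw (Metric.sphere_subset_closedBall hv), hs t⟩)
    (by simp)
    (by
      filter_upwards with t _ w hw
      have hwU : w ∈ U := hclU (hcl w hw (Metric.mem_closedBall_self hr0.le))
      exact (hdiff t w hwU).hasDerivAt.const_mul _)
  exact key.2.differentiableAt.differentiableWithinAt

/-! ### The odd theta function ϑ -/

section Theta

variable (z : ℂ) (τ : ℍ)

theorem theta_eq : theta z τ = Complex.exp (π * Complex.I * τ / 4 + π * Complex.I * (z + 1 / 2))
    * jacobiTheta₂ (z + 1 / 2 + τ / 2) τ := by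
  rw [theta, jacobiTheta₂, ← tsum_mul_left]
  refine tsum_congr fun n => ?_
  rw [jacobiTheta₂_term, ← Complex.exp_add]
  congr 1; ring

theorem theta_add_half : theta (z + 1 / 2) τ
    = -Complex.exp (π * Complex.I * τ / 4 + π * Complex.I * z) * jacobiTheta₂ (z + τ / 2) τ := by
  rw [theta_eq, show z + 1 / 2 + 1 / 2 + (τ : ℂ) / 2 = z + τ / 2 + 1 by ring,
    jacobiTheta₂_add_left, show (π * Complex.I * τ / 4 + π * Complex.I * (z + 1 / 2 + 1 / 2) : ℂ)
      = π * Complex.I * τ / 4 + π * Complex.I * z + π * Complex.I by ring, Complex.exp_add,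
    Complex.exp_pi_mul_I]
  ring

theorem differentiable_theta : Differentiable ℂ fun z => theta z τ := by
  intro z
  simp_rw [theta_eq]
  have h : DifferentiableAt ℂ (fun z : ℂ => jacobiTheta₂ (z + 1 / 2 + τ / 2) τ) z :=
    (differentiableAt_jacobiTheta₂_fst (z + 1 / 2 + τ / 2) τ.im_pos).comp z
      (f := fun z : ℂ => z + 1 / 2 + (τ : ℂ) / 2) (by fun_prop)
  exact DifferentiableAt.mul (by fun_prop) h

theorem theta_add_one : theta (z + 1) τ = -theta z τ := by
  rw [theta_eq, theta_eq, show z + 1 + 1 / 2 + (τ : ℂ) / 2 = z + 1 / 2 + τ / 2 + 1 by ring,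
    jacobiTheta₂_add_left, show (π * Complex.I * τ / 4 + π * Complex.I * (z + 1 + 1 / 2) : ℂ)
      = π * Complex.I * τ / 4 + π * Complex.I * (z + 1 / 2) + π * Complex.I by ring,
    Complex.exp_add _ (π * Complex.I), Complex.exp_pi_mul_I]
  ring

theorem theta_add_self : theta (z + τ) τ
    = -Complex.exp (-(π * Complex.I * τ) - 2 * π * Complex.I * z) * theta z τ := by
  rw [theta_eq, theta_eq, show z + τ + 1 / 2 + (τ : ℂ) / 2 = z + 1 / 2 + τ / 2 + τ by ring,
    jacobiTheta₂_add_left', ← mul_assoc, ← mul_assoc, ← Complex.exp_add,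
    neg_mul (Complex.exp _), ← Complex.exp_add,
    show (π * Complex.I * τ / 4 + π * Complex.I * (z + τ + 1 / 2)
      + -π * Complex.I * (τ + 2 * (z + 1 / 2 + τ / 2)) : ℂ)
      = (-(π * Complex.I * τ) - 2 * π * Complex.I * z + (π * Complex.I * τ / 4
        + π * Complex.I * (z + 1 / 2))) + -(π * Complex.I) by ring,
    Complex.exp_add _ (-(π * Complex.I)), Complex.exp_neg (π * Complex.I), Complex.exp_pi_mul_I]
  norm_num

theorem theta_neg : theta (-z) τ = -theta z τ := by
  rw [theta_eq, theta_eq, ← jacobiTheta₂_neg_left (-z + 1 / 2 + τ / 2),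
    ← jacobiTheta₂_add_left (-(-z + 1 / 2 + (τ : ℂ) / 2)),
    show z + 1 / 2 + (τ : ℂ) / 2 = -(-z + 1 / 2 + τ / 2) + 1 + τ by ring, jacobiTheta₂_add_left',
    ← mul_assoc, ← neg_mul, ← Complex.exp_add,
    show (π * Complex.I * τ / 4 + π * Complex.I * (z + 1 / 2)
      + -π * Complex.I * (τ + 2 * (-(-z + 1 / 2 + τ / 2) + 1)) : ℂ)
      = (π * Complex.I * τ / 4 + π * Complex.I * (-z + 1 / 2)) + -(π * Complex.I) by ring,
    Complex.exp_add _ (-(π * Complex.I)), Complex.exp_neg (π * Complex.I), Complex.exp_pi_mul_I]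
  norm_num

theorem theta_zero : theta 0 τ = 0 := by
  have := theta_neg 0 τ
  rw [neg_zero] at this
  exact self_eq_neg.1 this

/-- This is ϑ(0) = 0, written as ∑ (-1)ⁿ q^{n(n-1)/2} = 0. The sum is the error term when the Appell
sum is shifted by τ. -/
theorem jacobiTheta₂_half_sub : jacobiTheta₂ (1 / 2 - τ / 2) τ = 0 := by
  have h := theta_eq 0 τ
  rw [theta_zero, zero_add, eq_comm, mul_eq_zero, or_iff_right (Complex.exp_ne_zero _)] at h
  rw [← jacobiTheta₂_neg_left, ← jacobiTheta₂_add_left, ← h]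
  congr 1; ring

/-- Otherwise the full theta series would vanish on the real line, although its zeroth Fourier
coefficient is 1. -/
theorem exists_theta_ne_zero : ∃ z, theta z τ ≠ 0 := by
  by_contra! h
  have h0 : ∀ z, jacobiTheta₂ z τ = 0 := by
    intro z
    have := h (z - 1 / 2 - τ / 2)
    rw [theta_eq, mul_eq_zero, or_iff_right (Complex.exp_ne_zero _)] at this
    rw [← this]
    congr 1; ring
  have := integral_mul_zeta_zpow_of_hasSum (a := fun n => Complex.exp (π * Complex.I * n ^ 2 * τ))
    (f := fun z => jacobiTheta₂ z τ) (y := 0) (fun x => by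
      have := hasSum_jacobiTheta₂_term ((x : ℂ) + Complex.I * ((0 : ℝ) : ℂ)) τ.im_pos
      refine this.congr_fun ?_
      intro n
      rw [jacobiTheta₂_term, zeta_zpow, ← Complex.exp_add]
      congr 1; ring) 0
  simp [h0] at this

end Theta

/-! ### The Appell sum and the zeros of ϑ -/

section AppellSum

variable (τ : ℍ)

/-- The general term of the Appell sum `∑ (-1)ⁿ q^{n(n+1)/2} / (1 - ζ qⁿ)`, a multiple of the
reciprocal of the theta function. -/
noncomputable def appellTerm (n : ℤ) (z : ℂ) : ℂ :=
  Complex.exp (π * Complex.I * (n ^ 2 + n) * τ + π * Complex.I * n)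
    / (1 - Complex.exp (2 * π * Complex.I * (z + n * τ)))

/-- The part of the Appell sum that is regular in the strip `|Im z| < Im τ`. -/
noncomputable def appellRegular (z : ℂ) : ℂ := ∑' n : ℤ, if n = 0 then 0 else appellTerm τ n z

/-- The Appell sum `∑ (-1)ⁿ q^{n(n+1)/2} / (1 - ζ qⁿ)`. -/
noncomputable def appell (z : ℂ) : ℂ := (1 - zeta z)⁻¹ + appellRegular τ z

theorem appellTerm_zero (z : ℂ) : appellTerm τ 0 z = (1 - zeta z)⁻¹ := by
  simp [appellTerm, zeta]

/-- With t = 2π(Im τ - y), the modulus of ζqⁿ is at most e^{-t} for n > 0 and at least e^t for n <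
0. In the second case the claim follows from e^t + e^{-t} ≥ 2. -/
theorem norm_one_sub_exp_ge {y : ℝ} {z : ℂ} (hz : |z.im| ≤ y) (hy : y < τ.im) {n : ℤ}
    (hn : n ≠ 0) : 1 - Real.exp (-(2 * π * (τ.im - y)))
      ≤ ‖1 - Complex.exp (2 * π * Complex.I * (z + n * τ))‖ := by
  have hnorm : ‖Complex.exp (2 * π * Complex.I * (z + n * τ))‖
      = Real.exp (-(2 * π * (z.im + n * τ.im))) := by
    rw [Complex.norm_exp]; simp
  obtain ⟨hz1, hz2⟩ := abs_le.1 hz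
  have hτ := τ.im_pos
  rcases lt_or_gt_of_ne hn with h | h
  · have h1 : (n : ℝ) ≤ -1 := by exact_mod_cast Int.le_sub_one_of_lt h
    have h2 : τ.im - y ≤ -(z.im + n * τ.im) := by nlinarith
    have h3 : Real.exp (2 * π * (τ.im - y)) ≤ Real.exp (-(2 * π * (z.im + n * τ.im))) := by
      rw [Real.exp_le_exp]
      nlinarith [Real.pi_pos]
    have h4 := norm_sub_norm_le (Complex.exp (2 * π * Complex.I * (z + n * τ))) 1
    rw [norm_sub_rev, hnorm, norm_one] at h4
    have h5 := Real.add_one_le_exp (2 * π * (τ.im - y))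
    have h6 := Real.add_one_le_exp (-(2 * π * (τ.im - y)))
    linarith
  · have h1 : (1 : ℝ) ≤ n := by exact_mod_cast h
    have h2 : τ.im - y ≤ z.im + n * τ.im := by nlinarith
    have h3 : Real.exp (-(2 * π * (z.im + n * τ.im))) ≤ Real.exp (-(2 * π * (τ.im - y))) := by
      rw [Real.exp_le_exp]
      nlinarith [Real.pi_pos]
    have h4 := norm_sub_norm_le 1 (Complex.exp (2 * π * Complex.I * (z + n * τ)))
    rw [hnorm, norm_one] at h4
    linarith

theorem summable_norm_exp_appell : Summable fun n : ℤ =>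
    ‖Complex.exp (π * Complex.I * (n ^ 2 + n) * τ + π * Complex.I * n)‖ := by
  refine ((summable_jacobiTheta₂_term_iff (1 / 2 + τ / 2) τ).2 τ.im_pos).norm.congr fun n => ?_
  rw [jacobiTheta₂_term]
  congr 2; ring

theorem one_sub_exp_pos {y : ℝ} (hy : y < τ.im) : 0 < 1 - Real.exp (-(2 * π * (τ.im - y))) := by
  rw [sub_pos, Real.exp_lt_one_iff]
  have := mul_pos Real.two_pi_pos (sub_pos.2 hy)
  linarith

theorem norm_appellTerm_le {y : ℝ} {z : ℂ} (hz : |z.im| ≤ y) (hy : y < τ.im) (n : ℤ) :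
    ‖if n = 0 then 0 else appellTerm τ n z‖
      ≤ ‖Complex.exp (π * Complex.I * (n ^ 2 + n) * τ + π * Complex.I * n)‖
        * (1 - Real.exp (-(2 * π * (τ.im - y))))⁻¹ := by
  have h0 := one_sub_exp_pos τ hy
  split_ifs with hn
  · rw [norm_zero]
    positivity
  · rw [appellTerm, norm_div, div_eq_mul_inv]
    gcongr
    exact norm_one_sub_exp_ge τ hz hy hn

theorem differentiableAt_appellRegular {z : ℂ} (hz : |z.im| < τ.im) :
    DifferentiableAt ℂ (appellRegular τ) z := by
  obtain ⟨y, hy, hyτ⟩ := exists_between hz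
  have hU : IsOpen {w : ℂ | |w.im| < y} := isOpen_lt (by fun_prop) continuous_const
  have := Complex.differentiableOn_tsum_of_summable_norm
    (F := fun (n : ℤ) z => if n = 0 then 0 else appellTerm τ n z)
    ((summable_norm_exp_appell τ).mul_right _) (fun n => ?_) hU
    (fun n w hw => norm_appellTerm_le τ (le_of_lt hw) hyτ n)
  · exact this.differentiableAt (hU.mem_nhds hy)
  · split_ifs with hn
    · exact differentiableOn_const 0
    · intro w hw
      refine (DifferentiableAt.div (by fun_prop) (by fun_prop) ?_).differentiableWithinAt
      rw [← norm_pos_iff]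
      exact (one_sub_exp_pos τ hyτ).trans_le (norm_one_sub_exp_ge τ (le_of_lt hw) hyτ hn)

theorem hasSum_appellTerm {z : ℂ} (hz : |z.im| < τ.im) :
    HasSum (fun n => appellTerm τ n z) (appell τ z) := by
  have h : Summable fun n : ℤ => if n = 0 then 0 else appellTerm τ n z := by
    refine Summable.of_norm_bounded ((summable_norm_exp_appell τ).mul_right _)
      (norm_appellTerm_le τ (y := |z.im|) le_rfl hz)
  have h2 := (hasSum_ite_eq (0 : ℤ) (appellTerm τ 0 z)).add h.hasSum
  rw [appellTerm_zero] at h2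
  refine h2.congr_fun ?_
  intro n
  by_cases hn : n = 0 <;> simp [hn, appellTerm_zero]

theorem one_sub_zeta_ne_zero {z : ℂ} (hz : ∀ n : ℤ, z ≠ n) : 1 - zeta z ≠ 0 := by
  rw [sub_ne_zero, ne_comm, zeta, Ne, Complex.exp_eq_one_iff]
  rintro ⟨n, hn⟩
  refine hz n ?_
  have := Complex.two_pi_I_ne_zero
  refine mul_left_cancel₀ this ?_
  rw [hn]; ring

theorem zeta_add_one (z : ℂ) : zeta (z + 1) = zeta z := by
  rw [zeta, zeta, mul_add, Complex.exp_add, mul_one, Complex.exp_two_pi_mul_I, mul_one]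

theorem differentiableAt_appell {z : ℂ} (hz : |z.im| < τ.im) (hzn : ∀ n : ℤ, z ≠ n) :
    DifferentiableAt ℂ (appell τ) z := by
  refine DifferentiableAt.add ?_ (differentiableAt_appellRegular τ hz)
  refine DifferentiableAt.inv ?_ (one_sub_zeta_ne_zero hzn)
  unfold zeta
  fun_prop

theorem appell_add_one (z : ℂ) : appell τ (z + 1) = appell τ z := by
  have h : ∀ n, appellTerm τ n (z + 1) = appellTerm τ n z := by
    intro n
    rw [appellTerm, appellTerm, show 2 * π * Complex.I * (z + 1 + n * τ)
      = 2 * π * Complex.I * (z + n * τ) + 2 * π * Complex.I by ring,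
      Complex.exp_add _ (2 * π * Complex.I), Complex.exp_two_pi_mul_I, mul_one]
  simp [appell, appellRegular, h, zeta_add_one]

/-- After the shift n ↦ n - 1, the terms at z + τ differ from -ζ times the terms at z by -(-1)ⁿ
q^{n(n-1)/2}, whose sum is zero by `jacobiTheta₂_half_sub`. The condition on z keeps both points in
the strip and off the poles. -/
theorem appell_add_self {z : ℂ} (hz0 : z.im < 0) (hz : -τ.im < z.im) :
    appell τ (z + τ) = -zeta z * appell τ z := by
  have h1 := hasSum_appellTerm τ (z := z) (abs_lt.2 ⟨hz, by linarith [τ.im_pos]⟩)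
  have h2 := hasSum_appellTerm τ (z := z + τ)
    (abs_lt.2 ⟨by simp; linarith, by simp; linarith⟩)
  have h3 := hasSum_jacobiTheta₂_term (1 / 2 - τ / 2) τ.im_pos
  rw [jacobiTheta₂_half_sub] at h3
  have h4 := (h1.mul_left (-zeta z)).sub h3
  rw [sub_zero] at h4
  have h5 := (Equiv.subRight (1 : ℤ)).hasSum_iff.2 h2
  refine h5.unique (h4.congr_fun ?_)
  intro k
  have hne : 1 - Complex.exp (2 * π * Complex.I * (z + k * τ)) ≠ 0 := by
    by_cases hk : k = 0
    · have := one_sub_zeta_ne_zero (z := z) (by rintro n rfl; simp at hz0)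
      simpa [hk, zeta] using this
    · rw [← norm_pos_iff]
      exact (one_sub_exp_pos τ (abs_lt.2 ⟨hz, by linarith [τ.im_pos]⟩)).trans_le
        (norm_one_sub_exp_ge τ (le_refl |z.im|) (abs_lt.2 ⟨hz, by linarith [τ.im_pos]⟩) hk)
  simp only [Function.comp_apply, Equiv.subRight_apply, appellTerm, jacobiTheta₂_term, zeta,
    Int.cast_sub, Int.cast_one]
  rw [show z + (τ : ℂ) + ((k : ℂ) - 1) * τ = z + k * τ by ring, div_eq_iff hne, sub_mul,
    mul_assoc (-_) (_ / _), div_mul_cancel₀ _ hne, mul_one_sub, neg_mul, ← Complex.exp_add,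
    ← Complex.exp_add, show (π * Complex.I * (((k : ℂ) - 1) ^ 2 + (k - 1)) * τ + π * Complex.I * (k - 1) : ℂ)
      = 2 * π * Complex.I * k * (1 / 2 - τ / 2) + π * Complex.I * k ^ 2 * τ + -(π * Complex.I) by
        ring, Complex.exp_add _ (-(π * Complex.I)), Complex.exp_neg (π * Complex.I),
    Complex.exp_pi_mul_I,
    show (2 * π * Complex.I * k * (1 / 2 - τ / 2) + π * Complex.I * k ^ 2 * τ
      + 2 * π * Complex.I * (z + k * τ) : ℂ) = 2 * π * Complex.I * z
        + (π * Complex.I * (k ^ 2 + k) * τ + π * Complex.I * k) by ring]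
  rw [inv_neg, inv_one]
  ring

theorem tendsto_mul_appell : Tendsto (fun z => z * appell τ z) (𝓝[≠] 0)
    (𝓝 (-(2 * π * Complex.I)⁻¹)) := by
  have h1 : HasDerivAt (fun z => 1 - zeta z) (-(2 * π * Complex.I)) 0 := by
    have h : HasDerivAt (fun z : ℂ => 2 * π * Complex.I * z) (2 * π * Complex.I) 0 := by
      simpa using (hasDerivAt_id (0 : ℂ)).const_mul (2 * π * Complex.I)
    simpa [zeta] using (h.cexp.const_sub 1)
  have h2 := (hasDerivAt_iff_tendsto_slope.1 h1).inv₀ (neg_ne_zero.2 Complex.two_pi_I_ne_zero)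
  have h3 : Tendsto (fun z => z * appellRegular τ z) (𝓝[≠] 0) (𝓝 0) := by
    have hc := (differentiableAt_appellRegular τ (z := 0) (by simpa using τ.im_pos)).continuousAt
    have := (continuousAt_id.mul hc).tendsto
    simp only [id_eq, zero_mul, Pi.mul_apply] at this
    exact this.mono_left nhdsWithin_le_nhds
  have h4 := h2.add h3
  rw [add_zero, inv_neg] at h4
  refine h4.congr fun z => ?_
  have h0 : zeta 0 = 1 := by simp [zeta]
  simp only [slope_def_field, appell, h0, sub_self, sub_zero, inv_div]
  ring

variable {τ}

/-- The multipliers of the three factors cancel for both periods, and the zero of ϑ at 0 cancels the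
simple pole of the Appell sum. The product is thus constant, and its value is its limit at 0. -/
theorem exp_mul_appell_mul_theta {z : ℂ} (hz : |z.im| < τ.im) (hzn : ∀ n : ℤ, z ≠ n) :
    Complex.exp (π * Complex.I * z) * appell τ z * theta z τ
      = -(2 * π * Complex.I)⁻¹ * deriv (fun z => theta z τ) 0 := by
  refine eq_of_periodic_of_tendsto (τ := τ) τ.im_pos
    (F := fun z => Complex.exp (π * Complex.I * z) * appell τ z * theta z τ)
    (fun w hw hwn => ?_) (fun w => ?_) (fun w hw hwτ => ?_) ?_ hz hzn
  · exact ((by fun_prop : DifferentiableAt ℂ (fun z => Complex.exp (π * Complex.I * z)) w).mul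
      (differentiableAt_appell τ hw hwn)).mul (differentiable_theta τ w)
  · rw [appell_add_one, theta_add_one, mul_add, Complex.exp_add, mul_one, Complex.exp_pi_mul_I]
    ring
  · rw [appell_add_self τ hw hwτ, theta_add_self, zeta]
    have : Complex.exp (π * Complex.I * (w + τ)) * Complex.exp (2 * π * Complex.I * w)
        * Complex.exp (-(π * Complex.I * τ) - 2 * π * Complex.I * w)
        = Complex.exp (π * Complex.I * w) := by
      rw [← Complex.exp_add, ← Complex.exp_add]
      congr 1; ring
    rw [← this]
    ring
  · have h1 := hasDerivAt_iff_tendsto_slope.1 (differentiable_theta τ 0).hasDerivAt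
    have h2 : Tendsto (fun z : ℂ => Complex.exp (π * Complex.I * z)) (𝓝[≠] 0) (𝓝 1) := by
      have : Continuous fun z : ℂ => Complex.exp (π * Complex.I * z) := by fun_prop
      have := this.tendsto 0
      rw [mul_zero, Complex.exp_zero] at this
      exact this.mono_left nhdsWithin_le_nhds
    have h3 := h2.mul ((tendsto_mul_appell τ).mul h1)
    rw [one_mul] at h3
    refine h3.congr' ?_
    filter_upwards [self_mem_nhdsWithin] with z hz
    have hz : z ≠ 0 := hz
    rw [slope_def_field, theta_zero]
    field_simp
    ring

variable (τ) in
-- If ϑ'(0) = 0, the product in `exp_mul_appell_mul_theta` is zero. The Appell sum has a genuine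
-- pole at 0, so ϑ would vanish near 0 and hence identically.
theorem deriv_theta_ne_zero : deriv (fun z => theta z τ) 0 ≠ 0 := by
  intro h0
  have hA : ∀ᶠ z in 𝓝[≠] (0 : ℂ), z * appell τ z ≠ 0 :=
    (tendsto_mul_appell τ).eventually_ne
      (neg_ne_zero.2 (inv_ne_zero Complex.two_pi_I_ne_zero))
  have hs : {z : ℂ | |z.im| < τ.im} ∈ 𝓝[≠] (0 : ℂ) := by
    refine mem_nhdsWithin_of_mem_nhds (IsOpen.mem_nhds ?_ (by simpa using τ.im_pos))
    exact isOpen_lt (by fun_prop) continuous_const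
  have hθ : ∀ᶠ z in 𝓝[≠] (0 : ℂ), theta z τ = 0 := by
    filter_upwards [hA, hs, eventually_ne_intCast_nhdsNE_zero] with z hz1 hz2 hz3
    have := exp_mul_appell_mul_theta hz2 hz3
    rw [h0, mul_zero, mul_eq_zero] at this
    refine this.resolve_left (mul_ne_zero (Complex.exp_ne_zero _) (right_ne_zero_of_mul hz1))
  obtain ⟨z, hz⟩ := exists_theta_ne_zero τ
  refine hz ?_
  have han : AnalyticOnNhd ℂ (fun z => theta z τ) Set.univ := fun w _ =>
    (differentiable_theta τ).analyticAt w
  exact han.eqOn_zero_of_preconnected_of_frequently_eq_zero isPreconnected_univ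
    (Set.mem_univ 0) hθ.frequently (Set.mem_univ z)

/-- The theta function has no zeros in the strip `|Im z| < Im τ` except the integers. -/
theorem theta_ne_zero {z : ℂ} (hz : |z.im| < τ.im) (hzn : ∀ n : ℤ, z ≠ n) : theta z τ ≠ 0 := by
  have h := exp_mul_appell_mul_theta hz hzn
  have hne : -(2 * π * Complex.I)⁻¹ * deriv (fun z => theta z τ) 0 ≠ 0 :=
    mul_ne_zero (neg_ne_zero.2 (inv_ne_zero Complex.two_pi_I_ne_zero)) (deriv_theta_ne_zero τ)
  rw [← h] at hne
  exact right_ne_zero_of_mul hne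

end AppellSum

/-! ### Three theta quotients and their Laurent coefficients -/

section

/-- The three even theta functions. -/
noncomputable def thetaEven (k : Fin 3) (z : ℂ) (τ : ℍ) : ℂ :=
  match k with
  | 0 => theta (z + 1 / 2) τ
  | 1 => jacobiTheta₂ z τ
  | 2 => jacobiTheta₂ (z + 1 / 2) τ

/-- The `m`-th power of the quotient of an even theta function by the odd one. For `k = 0` this
is `φ`. -/
noncomputable def phiGen (m : ℕ) (k : Fin 3) (z : ℂ) (τ : ℍ) : ℂ :=
  (thetaEven k z τ / theta z τ) ^ m

/-- The holomorphic function `z ^ m * phiGen m k z τ` near `z = 0`. -/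
noncomputable def phiReg (m : ℕ) (k : Fin 3) (τ : ℍ) (z : ℂ) : ℂ :=
  (thetaEven k z τ / dslope (fun z => theta z τ) 0 z) ^ m

/-- The coefficient of `(2 π i z) ^ (-j)` in the Laurent expansion of `phiGen m k z τ` at `0`. -/
noncomputable def DGen (m : ℕ) (k : Fin 3) (j : ℕ) (τ : ℍ) : ℂ :=
  (2 * π * Complex.I) ^ j * laurentCoeff (fun z => phiGen m k z τ) 0 (-(j : ℤ))

theorem DGen_zero (m : ℕ) : DGen m 0 = D m := rfl

variable (m : ℕ) (k : Fin 3) (τ : ℍ)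

theorem differentiable_jacobiTheta₂_fst : Differentiable ℂ fun z => jacobiTheta₂ z τ :=
  fun z => differentiableAt_jacobiTheta₂_fst z τ.im_pos

theorem differentiable_thetaEven : Differentiable ℂ fun z => thetaEven k z τ := by
  match k with
  | 0 => exact (differentiable_theta τ).comp (f := fun z : ℂ => z + 1 / 2) (by fun_prop)
  | 1 => exact differentiable_jacobiTheta₂_fst τ
  | 2 => exact (differentiable_jacobiTheta₂_fst τ).comp (f := fun z : ℂ => z + 1 / 2) (by fun_prop)

theorem thetaEven_neg (z : ℂ) : thetaEven k (-z) τ = thetaEven k z τ := by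
  match k with
  | 0 =>
    change theta (-z + 1 / 2) τ = theta (z + 1 / 2) τ
    rw [← neg_neg (-z + 1 / 2), theta_neg, ← theta_add_one]
    congr 1; ring
  | 1 => exact jacobiTheta₂_neg_left z τ
  | 2 =>
    change jacobiTheta₂ (-z + 1 / 2) τ = jacobiTheta₂ (z + 1 / 2) τ
    rw [← jacobiTheta₂_neg_left, ← jacobiTheta₂_add_left]
    congr 1; ring

theorem phiGen_eq {z : ℂ} (hz : z ≠ 0) : phiGen m k z τ = phiReg m k τ z / z ^ m := by
  rw [phiGen, phiReg, ← div_pow, div_div, dslope_of_ne _ hz, slope_def_field, theta_zero, sub_zero,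
    sub_zero, div_mul_cancel₀ _ hz]

theorem abs_im_lt_and_ne_intCast {z : ℂ} (hz : z ∈ Metric.ball (0 : ℂ) (min 1 τ.im)) (h0 : z ≠ 0) :
    |z.im| < τ.im ∧ ∀ n : ℤ, z ≠ n := by
  rw [mem_ball_zero_iff, lt_min_iff] at hz
  refine ⟨(Complex.abs_im_le_norm z).trans_lt hz.2, fun n hn => h0 ?_⟩
  have h1 := hz.1
  rw [hn, Complex.norm_intCast] at h1
  have : n = 0 := Int.abs_lt_one_iff.1 (by exact_mod_cast h1)
  simp [hn, this]

theorem dslope_theta_ne_zero {z : ℂ} (hz : z ∈ Metric.ball (0 : ℂ) (min 1 τ.im)) :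
    dslope (fun z => theta z τ) 0 z ≠ 0 := by
  by_cases h0 : z = 0
  · rw [h0, dslope_same]
    exact deriv_theta_ne_zero τ
  · obtain ⟨h1, h2⟩ := abs_im_lt_and_ne_intCast τ hz h0
    rw [dslope_of_ne _ h0, slope_def_field, theta_zero, sub_zero, sub_zero]
    exact div_ne_zero (theta_ne_zero h1 h2) h0

theorem min_one_im_pos : 0 < min 1 τ.im := lt_min one_pos τ.im_pos

theorem differentiableOn_phiReg :
    DifferentiableOn ℂ (phiReg m k τ) (Metric.ball 0 (min 1 τ.im)) := by
  refine DifferentiableOn.pow (DifferentiableOn.div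
    (differentiable_thetaEven k τ).differentiableOn ?_ fun z hz => dslope_theta_ne_zero τ hz) m
  exact (Complex.differentiableOn_dslope (Metric.ball_mem_nhds _ (min_one_im_pos τ))).2
    (differentiable_theta τ).differentiableOn

variable {m}

theorem dslope_theta_neg (z : ℂ) :
    dslope (fun z => theta z τ) 0 (-z) = dslope (fun z => theta z τ) 0 z := by
  by_cases h0 : z = 0
  · simp [h0]
  · rw [dslope_of_ne _ h0, dslope_of_ne _ (neg_ne_zero.2 h0), slope_def_field, slope_def_field,
      theta_neg, theta_zero]
    simp

theorem iteratedDeriv_phiReg_odd {i : ℕ} (hi : Odd i) : iteratedDeriv i (phiReg m k τ) 0 = 0 := by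
  have h := iteratedDeriv_comp_neg i (phiReg m k τ) 0
  have e : (fun z => phiReg m k τ (-z)) = phiReg m k τ := by
    funext z
    rw [phiReg, phiReg, thetaEven_neg, dslope_theta_neg]
  rw [e, neg_zero, hi.neg_one_pow, neg_one_smul] at h
  exact self_eq_neg.1 h

theorem DGen_eq_iteratedDeriv {i j : ℕ} (h : i + j = m) : DGen m k j τ
    = (2 * π * Complex.I) ^ j * (iteratedDeriv i (phiReg m k τ) 0 / (i ! : ℕ)) := by
  rw [DGen, laurentCoeff_eq_iteratedDeriv (i := i) (min_one_im_pos τ) (differentiableOn_phiReg m k τ)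
    (fun z _ hz => phiGen_eq m k τ hz) (by rw [← h]; push_cast; ring)]

/-- Replaces the limit over radii by one fixed circle, so that τ can vary. Holomorphy in τ and the
bound at i∞ both rest on this. -/
theorem DGen_eq_circleIntegral {j : ℕ} (h : j ≤ m) {ρ : ℝ} (h0 : 0 < ρ) (hρ : ρ < min 1 τ.im) :
    DGen m k j τ = (2 * π * Complex.I) ^ j * ((2 * π * Complex.I)⁻¹
      * ∮ z in C(0, ρ), phiGen m k z τ * (z - 0) ^ (-(-(j : ℤ)) - 1)) := by
  obtain ⟨i, rfl⟩ := Nat.exists_eq_add_of_le' h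
  rw [DGen_eq_iteratedDeriv k τ (i := i) (j := j) rfl]
  congr 1
  exact (circleIntegral_eq_iteratedDeriv (differentiableOn_phiReg _ k τ)
    (fun z _ hz => phiGen_eq _ k τ hz) (by push_cast; ring) h0 hρ).symm

theorem sum_range_two_mul {M : Type*} [AddCommMonoid M] (f : ℕ → M) (n : ℕ) :
    ∑ i ∈ Finset.range (2 * n), f i = ∑ l ∈ Finset.range n, (f (2 * l) + f (2 * l + 1)) := by
  induction n with
  | zero => simp
  | succ n ih =>
    rw [Finset.sum_range_succ, ← ih, mul_add, Finset.sum_range_succ, Finset.sum_range_succ,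
      add_assoc]

/-- The Laurent expansion of `φ` at `0`. -/
theorem phiGen_sub_sum_isBigO (hm : Even m) :
    (fun z : ℂ => phiGen m k z τ - ∑ j ∈ Finset.Icc 0 (m / 2),
      DGen m k (2 * j) τ / (2 * (π : ℂ) * Complex.I * z) ^ (2 * j))
      =O[𝓝[≠] (0 : ℂ)] fun z : ℂ => z ^ 2 := by
  obtain ⟨n, rfl⟩ := hm
  have han : AnalyticAt ℂ (phiReg (n + n) k τ) 0 :=
    (differentiableOn_phiReg (n + n) k τ).analyticAt (Metric.ball_mem_nhds _ (min_one_im_pos τ))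
  -- With m = 2n, the Taylor polynomial of z^m φ is taken up to degree 2n + 1. Its odd coefficients
  -- vanish since the function is even, so the error is O(z^{2n+2}), which becomes O(z²) after
  -- division by z^{2n}.
  have h1 := (han.hasFPowerSeriesAt.isBigO_sub_partialSum_pow (2 * (n + 1))).mono
    (nhdsWithin_le_nhds (s := {0}ᶜ))
  have h2 : (fun z : ℂ => (z ^ (n + n))⁻¹) =O[𝓝[≠] (0 : ℂ)] fun z : ℂ => (z ^ (n + n))⁻¹ :=
    isBigO_refl _ _
  have h3 := h1.mul h2.norm_right
  refine (h3.congr' ?_ ?_).of_norm_right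
  · filter_upwards [self_mem_nhdsWithin] with z hz
    have hz : z ≠ 0 := hz
    rw [zero_add, phiGen_eq _ _ _ hz, sub_mul, ← div_eq_mul_inv]
    congr 1
    -- The reflection of the index pairs the Taylor degree 2(n - l) with the pole order 2l.
    rw [FormalMultilinearSeries.partialSum, sum_range_two_mul, Finset.sum_mul,
      show (n + n) / 2 = n by omega, ← Nat.range_succ_eq_Icc_zero, ← Finset.sum_range_reflect]
    refine Finset.sum_congr rfl fun l hl => ?_
    have hl : l ≤ n := Nat.lt_succ_iff.1 (Finset.mem_range.1 hl)
    rw [FormalMultilinearSeries.ofScalars_apply_eq, FormalMultilinearSeries.ofScalars_apply_eq,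
      iteratedDeriv_phiReg_odd k τ (odd_two_mul_add_one _), zero_div, zero_smul, add_zero,
      DGen_eq_iteratedDeriv k τ (i := 2 * (n + 1 - 1 - l)) (j := 2 * l) (by omega), mul_pow _ z,
      mul_div_mul_left _ _ (pow_ne_zero _ Complex.two_pi_I_ne_zero), smul_eq_mul]
    have : z ^ (n + n) = z ^ (2 * (n + 1 - 1 - l)) * z ^ (2 * l) := by
      rw [← pow_add]; congr 1; omega
    rw [this]
    field_simp
  · filter_upwards [self_mem_nhdsWithin] with z hz
    have hz : z ≠ 0 := hz
    rw [← norm_pow, ← norm_mul, show 2 * (n + 1) = 2 + (n + n) by ring, pow_add, mul_assoc,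
      mul_inv_cancel₀ (pow_ne_zero _ hz), mul_one]

theorem theta_add_self_add_half (z : ℂ) : theta (z + τ + 1 / 2) τ
    = Complex.exp (-(π * Complex.I * τ) - 2 * π * Complex.I * z) * theta (z + 1 / 2) τ := by
  rw [show z + (τ : ℂ) + 1 / 2 = z + 1 / 2 + τ by ring, theta_add_self,
    show (-(π * Complex.I * τ) - 2 * π * Complex.I * (z + 1 / 2) : ℂ)
      = -(π * Complex.I * τ) - 2 * π * Complex.I * z + -(π * Complex.I) by ring,
    Complex.exp_add _ (-(π * Complex.I)), Complex.exp_neg (π * Complex.I), Complex.exp_pi_mul_I,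
    inv_neg, inv_one]
  ring

theorem phi_add_one (z : ℂ) : phi m (z + 1) τ = phi m z τ := by
  rw [phi, phi, show z + 1 + 1 / 2 = z + 1 / 2 + 1 by ring, theta_add_one, theta_add_one,
    neg_div_neg_eq]

/-- The theta quotient itself changes sign under z ↦ z + τ; the even power removes the sign. -/
theorem phi_add_self (hm : Even m) (z : ℂ) : phi m (z + τ) τ = phi m z τ := by
  rw [phi, phi, theta_add_self_add_half, theta_add_self, neg_mul, div_neg,
    mul_div_mul_left _ _ (Complex.exp_ne_zero _), hm.neg_pow]

theorem differentiableAt_phi {z : ℂ} (hz : |z.im| < τ.im) (hzn : ∀ n : ℤ, z ≠ n) :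
    DifferentiableAt ℂ (fun z => phi m z τ) z :=
  ((differentiable_thetaEven 0 τ z).div (differentiable_theta τ z) (theta_ne_zero hz hzn)).pow m

end

/-! ### The sums ∑ (z + n)^{-(k+1)} -/

section LipschitzSum

/-- The sum `∑ (z + n) ^ (-(k + 1))` over the integers. -/
noncomputable def lipschitzSum (k : ℕ) (z : ℂ) : ℂ := ∑' n : ℤ, 1 / (z + n) ^ (k + 1)

variable {k : ℕ}

theorem lipschitzSum_neg (hk : Odd k) (z : ℂ) : lipschitzSum k (-z) = lipschitzSum k z := by
  rw [lipschitzSum, lipschitzSum, ← (Equiv.neg ℤ).tsum_eq]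
  refine tsum_congr fun n => ?_
  rw [← hk.add_one.neg_pow]
  simp only [Equiv.neg_apply, Int.cast_neg]
  congr 2; ring

theorem lipschitzSum_add_one (z : ℂ) : lipschitzSum k (z + 1) = lipschitzSum k z := by
  rw [lipschitzSum, lipschitzSum, ← (Equiv.subRight (1 : ℤ)).tsum_eq]
  refine tsum_congr fun n => ?_
  simp only [Equiv.subRight_apply, Int.cast_sub, Int.cast_one]
  congr 2; ring

theorem natCast_lt_abs_intCast {n : ℤ} {N : ℕ} (h : ¬n.natAbs ≤ N) : (N : ℝ) < |(n : ℝ)| := by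
  have h1 : (N : ℤ) < |n| := by rw [Int.abs_eq_natAbs]; omega
  exact_mod_cast h1

/-- For |n| > N ≥ 2R > 2|z| one has |z + n| ≥ |n|/2. Away from finitely many terms the sum thus has
a summable majorant on the disc. -/
theorem norm_ite_one_div_pow_le {N : ℕ} {R : ℝ} (hN : 2 * R ≤ N) {z : ℂ} (hz : ‖z‖ < R) (n : ℤ) :
    ‖if n.natAbs ≤ N then 0 else 1 / (z + n) ^ (k + 1)‖
      ≤ 2 ^ (k + 1) * |1 / (n : ℝ) ^ (k + 1)| := by
  split_ifs with h
  · rw [norm_zero]; positivity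
  · have h1 : (N : ℝ) < |(n : ℝ)| := natCast_lt_abs_intCast h
    have h2 := norm_sub_norm_le (n : ℂ) (-z)
    rw [norm_neg, Complex.norm_intCast, sub_neg_eq_add, add_comm] at h2
    have h3 : |(n : ℝ)| / 2 ≤ ‖z + n‖ := by linarith
    have h0 : 0 < |(n : ℝ)| := (Nat.cast_nonneg N).trans_lt h1
    rw [norm_div, norm_one, norm_pow, abs_div, abs_one, abs_pow]
    calc 1 / ‖z + n‖ ^ (k + 1) ≤ 1 / (|(n : ℝ)| / 2) ^ (k + 1) := by gcongr
      _ = _ := by rw [div_pow]; field_simp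

theorem summable_two_pow_mul_abs (hk : 1 ≤ k) :
    Summable fun n : ℤ => (2 : ℝ) ^ (k + 1) * |1 / (n : ℝ) ^ (k + 1)| :=
  (Real.summable_one_div_int_pow.2 (by omega)).abs.mul_left _

theorem natAbs_le_finite (N : ℕ) : {n : ℤ | n.natAbs ≤ N}.Finite :=
  (Set.finite_Icc (-(N : ℤ)) N).subset fun n hn => by
    simp only [Set.mem_ofPred_eq] at hn
    simp only [Set.mem_Icc]
    omega

theorem lipschitzSum_eq (hk : 1 ≤ k) {N : ℕ} {R : ℝ} (hN : 2 * R ≤ N) {z : ℂ} (hz : ‖z‖ < R) :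
    lipschitzSum k z = (∑ n ∈ (natAbs_le_finite N).toFinset, 1 / (z + n) ^ (k + 1))
      + ∑' n : ℤ, if n.natAbs ≤ N then 0 else 1 / (z + n) ^ (k + 1) := by
  have h1 : Summable fun n : ℤ => if n.natAbs ≤ N then 0 else 1 / (z + n) ^ (k + 1) :=
    Summable.of_norm_bounded (summable_two_pow_mul_abs hk) (norm_ite_one_div_pow_le hN hz)
  have h2 : HasSum (fun n : ℤ => if n.natAbs ≤ N then 1 / (z + n) ^ (k + 1) else 0)
      (∑ n ∈ (natAbs_le_finite N).toFinset, 1 / (z + n) ^ (k + 1)) := by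
    have := hasSum_sum_of_ne_finset_zero (L := .unconditional ℤ)
      (f := fun n : ℤ => if n.natAbs ≤ N then 1 / (z + n) ^ (k + 1) else 0)
      (s := (natAbs_le_finite N).toFinset) (fun n hn => if_neg (by simpa using hn))
    convert this using 1
    refine Finset.sum_congr rfl fun n hn => (if_pos (by simpa using hn)).symm
  refine ((h2.add h1.hasSum).congr_fun ?_).tsum_eq
  intro n
  split_ifs <;> simp

theorem differentiableOn_tsum_ite (hk : 1 ≤ k) {N : ℕ} {R : ℝ} (hN : 2 * R ≤ N) :
    DifferentiableOn ℂ (fun z : ℂ => ∑' n : ℤ, if n.natAbs ≤ N then 0 else 1 / (z + n) ^ (k + 1))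
      (Metric.ball 0 R) := by
  refine Complex.differentiableOn_tsum_of_summable_norm (summable_two_pow_mul_abs hk)
    (fun n => ?_) Metric.isOpen_ball
    (fun n z hz => norm_ite_one_div_pow_le hN (mem_ball_zero_iff.1 hz) n)
  split_ifs with h
  · exact differentiableOn_const 0
  · intro z hz
    refine (DifferentiableAt.div (by fun_prop) (by fun_prop)
      (pow_ne_zero _ fun h0 => ?_)).differentiableWithinAt
    have h1 : ‖z‖ = |(n : ℝ)| := by
      rw [eq_neg_of_add_eq_zero_left h0, norm_neg, Complex.norm_intCast]
    have h2 := mem_ball_zero_iff.1 hz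
    have h3 : (N : ℝ) < |(n : ℝ)| := natCast_lt_abs_intCast h
    have := norm_nonneg z
    linarith

theorem differentiableAt_lipschitzSum (hk : 1 ≤ k) {z : ℂ} (hz : ∀ n : ℤ, z ≠ n) :
    DifferentiableAt ℂ (lipschitzSum k) z := by
  obtain ⟨N, hN⟩ := exists_nat_ge (2 * (‖z‖ + 1))
  have hb : Metric.ball (0 : ℂ) (‖z‖ + 1) ∈ 𝓝 z :=
    Metric.isOpen_ball.mem_nhds (by simp)
  have h1 := (differentiableOn_tsum_ite hk hN).differentiableAt hb
  have h2 : DifferentiableAt ℂ (fun z : ℂ => ∑ n ∈ (natAbs_le_finite N).toFinset,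
      1 / (z + n) ^ (k + 1)) z := by
    refine DifferentiableAt.fun_sum fun n _ => DifferentiableAt.div (by fun_prop) (by fun_prop)
      (pow_ne_zero _ fun h0 => hz (-n) ?_)
    rw [eq_neg_of_add_eq_zero_left h0]; simp
  refine (h2.add h1).congr_of_eventuallyEq ?_
  filter_upwards [hb] with w hw
  exact lipschitzSum_eq hk hN (mem_ball_zero_iff.1 hw)

theorem tendsto_lipschitzSum_sub (hk : Odd k) :
    Tendsto (fun z => lipschitzSum k z - 1 / z ^ (k + 1)) (𝓝[≠] 0)
      (𝓝 (2 * riemannZeta ((k + 1 : ℕ) : ℂ))) := by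
  have hk1 : 1 ≤ k := hk.pos
  have hN : 2 * (1 / 2 : ℝ) ≤ (1 : ℕ) := by norm_num
  let h : ℂ → ℂ := fun z => (∑ n ∈ (natAbs_le_finite 1).toFinset.erase 0, 1 / (z + n) ^ (k + 1))
      + ∑' n : ℤ, if n.natAbs ≤ 1 then 0 else 1 / (z + n) ^ (k + 1)
  have hb : Metric.ball (0 : ℂ) (1 / 2) ∈ 𝓝 0 := Metric.ball_mem_nhds _ (by norm_num)
  have heq : ∀ z ∈ Metric.ball (0 : ℂ) (1 / 2), lipschitzSum k z - 1 / z ^ (k + 1) = h z := by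
    intro z hz
    rw [lipschitzSum_eq hk1 hN (mem_ball_zero_iff.1 hz),
      ← Finset.add_sum_erase (natAbs_le_finite 1).toFinset _ (a := 0) (by simp)]
    simp only [h, Int.cast_zero, add_zero]
    ring
  have hcont : ContinuousAt h 0 := by
    refine ContinuousAt.add ?_ ((differentiableOn_tsum_ite hk1 hN).differentiableAt hb).continuousAt
    refine DifferentiableAt.continuousAt (𝕜 := ℂ) (DifferentiableAt.fun_sum fun n hn =>
      DifferentiableAt.div (by fun_prop) (by fun_prop) (pow_ne_zero _ ?_))
    rw [zero_add]
    exact_mod_cast Finset.ne_of_mem_erase hn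
  have h0 : h 0 = 2 * riemannZeta ((k + 1 : ℕ) : ℂ) := by
    -- At z = 0 the singular terms are 1/0 = 0 in Lean, so the value of the regular part there is
    -- the sum of n^{-(k+1)} over n ≠ 0.
    rw [← heq 0 (mem_of_mem_nhds hb), two_mul_riemannZeta_eq_tsum_int_inv_pow_of_even (by omega)
      hk.add_one, lipschitzSum]
    simp
  rw [← h0]
  refine (hcont.tendsto.mono_left nhdsWithin_le_nhds).congr' ?_
  filter_upwards [mem_nhdsWithin_of_mem_nhds hb] with z hz using (heq z hz).symm

end LipschitzSum

/-! ### Elliptic functions with prescribed principal part -/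

section Elliptic

variable (k : ℕ) (τ : ℍ)

theorem norm_nome_lt_one : ‖nome τ‖ < 1 := by
  have : nome τ = zeta τ := rfl
  rw [this, norm_zeta, Real.exp_lt_one_iff]
  have := mul_pos Real.two_pi_pos τ.im_pos
  simpa using this

theorem zeta_add_self (z : ℂ) : zeta (z + τ) = zeta z * nome τ := by
  rw [zeta, zeta, nome, ← Complex.exp_add]; congr 1; ring

theorem zeta_neg (z : ℂ) : zeta (-z) = (zeta z)⁻¹ := by
  rw [zeta, zeta, ← Complex.exp_neg]; congr 1; ring

/-- The general term of the Lambert series `∑ s ^ k (ζ ^ s + ζ ^ (-s)) q ^ s / (1 - q ^ s)`. -/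
noncomputable def lambertTerm (s : ℕ) (z : ℂ) : ℂ :=
  s ^ k * (zeta z ^ s + (zeta z)⁻¹ ^ s) * (nome τ ^ s / (1 - nome τ ^ s))

/-- A function with periods `1` and `τ` whose only singularity in the strip `|Im z| < Im τ` modulo
`1` is `(2 π i z) ^ (-(k + 1))` at `0`. -/
noncomputable def ellipticSum (z : ℂ) : ℂ :=
  ((2 * π * Complex.I) ^ (k + 1))⁻¹ * lipschitzSum k z
    + (k ! : ℂ)⁻¹ * ∑' s : ℕ, lambertTerm k τ s z

variable {k}

theorem one_sub_norm_nome_le {s : ℕ} (hs : s ≠ 0) : 1 - ‖nome τ‖ ≤ ‖1 - nome τ ^ s‖ := by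
  have h4 := norm_sub_norm_le 1 (nome τ ^ s)
  rw [norm_one, norm_pow] at h4
  have h5 := pow_le_of_le_one (norm_nonneg (nome τ)) (norm_nome_lt_one τ).le hs
  linarith

theorem norm_lambertTerm_le (hk : k ≠ 0) {y : ℝ} {z : ℂ} (hz : |z.im| ≤ y) (s : ℕ) :
    ‖lambertTerm k τ s z‖ ≤ ‖(s : ℝ) ^ k * (‖nome τ‖ * Real.exp (2 * π * y)) ^ s‖
      * (2 / (1 - ‖nome τ‖)) := by
  have hq := norm_nome_lt_one τ
  have hq' : 0 < 1 - ‖nome τ‖ := by linarith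
  rcases Nat.eq_zero_or_pos s with rfl | hs
  · simp [lambertTerm, hk]
  obtain ⟨hz1, hz2⟩ := abs_le.1 hz
  have h1 : ‖zeta z‖ ≤ Real.exp (2 * π * y) := by
    rw [norm_zeta, Real.exp_le_exp]
    nlinarith [Real.pi_pos]
  have h2 : ‖(zeta z)⁻¹‖ ≤ Real.exp (2 * π * y) := by
    rw [← zeta_neg, norm_zeta, Real.exp_le_exp, Complex.neg_im]
    nlinarith [Real.pi_pos]
  have h3 : 1 - ‖nome τ‖ ≤ ‖1 - nome τ ^ s‖ := one_sub_norm_nome_le τ hs.ne'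
  rw [lambertTerm, norm_mul, norm_mul, norm_div, norm_pow, norm_pow, Complex.norm_natCast,
    norm_mul, norm_pow, norm_pow, Real.norm_natCast, Real.norm_of_nonneg (by positivity), mul_pow]
  have h6 : ‖zeta z ^ s + (zeta z)⁻¹ ^ s‖ ≤ 2 * Real.exp (2 * π * y) ^ s := by
    refine (norm_add_le _ _).trans ?_
    rw [norm_pow, norm_pow, two_mul]
    gcongr
  calc (s : ℝ) ^ k * ‖zeta z ^ s + (zeta z)⁻¹ ^ s‖ * (‖nome τ‖ ^ s / ‖1 - nome τ ^ s‖)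
      ≤ (s : ℝ) ^ k * (2 * Real.exp (2 * π * y) ^ s) * (‖nome τ‖ ^ s / (1 - ‖nome τ‖)) := by
        gcongr
    _ = _ := by ring

theorem summable_lambert_bound {y : ℝ} (hy : y < τ.im) : Summable fun s : ℕ =>
    ‖(s : ℝ) ^ k * (‖nome τ‖ * Real.exp (2 * π * y)) ^ s‖ * (2 / (1 - ‖nome τ‖)) := by
  refine (summable_norm_pow_mul_geometric_of_norm_lt_one k ?_).mul_right _
  have : nome τ = zeta τ := rfl
  rw [Real.norm_of_nonneg (by positivity), this, norm_zeta, ← Real.exp_add, Real.exp_lt_one_iff]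
  have h := mul_pos Real.two_pi_pos (sub_pos.2 hy)
  have e : (τ : ℂ).im = τ.im := rfl
  rw [e]
  linarith

theorem summable_lambertTerm (hk : k ≠ 0) {z : ℂ} (hz : |z.im| < τ.im) :
    Summable fun s => lambertTerm k τ s z :=
  Summable.of_norm_bounded (summable_lambert_bound τ hz) (norm_lambertTerm_le τ hk le_rfl)

theorem differentiableAt_tsum_lambertTerm (hk : k ≠ 0) {z : ℂ} (hz : |z.im| < τ.im) :
    DifferentiableAt ℂ (fun z => ∑' s, lambertTerm k τ s z) z := by
  obtain ⟨y, hy, hyτ⟩ := exists_between hz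
  have hU : IsOpen {w : ℂ | |w.im| < y} := isOpen_lt (by fun_prop) continuous_const
  refine (Complex.differentiableOn_tsum_of_summable_norm (summable_lambert_bound (k := k) τ hyτ)
    (fun s => ?_) hU (fun s w hw => norm_lambertTerm_le τ hk (le_of_lt hw) s)).differentiableAt
    (hU.mem_nhds hy)
  have h1 : Differentiable ℂ zeta := by unfold zeta; fun_prop
  have h2 : Differentiable ℂ fun z => (zeta z)⁻¹ := fun z => (h1 z).inv (zeta_ne_zero z)
  exact (((h1.pow s).add (h2.pow s)).const_mul _ |>.mul_const _).differentiableOn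

theorem differentiableAt_ellipticSum (hk : k ≠ 0) {z : ℂ} (hz : |z.im| < τ.im)
    (hzn : ∀ n : ℤ, z ≠ n) : DifferentiableAt ℂ (ellipticSum k τ) z :=
  ((differentiableAt_lipschitzSum (Nat.one_le_iff_ne_zero.2 hk) hzn).const_mul _).add
    ((differentiableAt_tsum_lambertTerm τ hk hz).const_mul _)

theorem ellipticSum_add_one (z : ℂ) : ellipticSum k τ (z + 1) = ellipticSum k τ z := by
  simp only [ellipticSum, lipschitzSum_add_one, lambertTerm, zeta_add_one]

theorem ellipticSum_neg (hk : Odd k) (z : ℂ) : ellipticSum k τ (-z) = ellipticSum k τ z := by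
  simp only [ellipticSum, lipschitzSum_neg hk, lambertTerm, zeta_neg, inv_inv]
  congr 3
  funext s
  ring

theorem one_sub_nome_pow_ne_zero {s : ℕ} (hs : s ≠ 0) : 1 - nome τ ^ s ≠ 0 := by
  intro h
  have h1 : ‖nome τ ^ s‖ = 1 := by rw [← sub_eq_zero.1 h, norm_one]
  rw [norm_pow] at h1
  exact (pow_lt_one₀ (norm_nonneg _) (norm_nome_lt_one τ) hs).ne h1

theorem nome_ne_zero : nome τ ≠ 0 := Complex.exp_ne_zero _

/-- The Fourier expansion of `ellipticSum` in the strip `0 < Im z < Im τ`. -/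
theorem hasSum_ellipticSum (hk : Odd k) {z : ℂ} (hz0 : 0 < z.im) (hz : z.im < τ.im) :
    HasSum (fun r : ℤ => 1 / (1 - nome τ ^ r) * ((r : ℂ) ^ k / (k ! : ℂ)) * zeta z ^ r)
      (ellipticSum k τ z) := by
  have hk0 : k ≠ 0 := hk.pos.ne'
  have habs : |z.im| < τ.im := abs_lt.2 ⟨by linarith [τ.im_pos], hz⟩
  have hζ : ‖zeta z‖ < 1 := by
    rw [norm_zeta, Real.exp_lt_one_iff]
    linarith [mul_pos Real.two_pi_pos hz0]
  have hζq : ‖(zeta z)⁻¹ * nome τ‖ < 1 := by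
    have e : (zeta z)⁻¹ * nome τ = zeta (-z + τ) := by rw [zeta_add_self, zeta_neg]
    rw [e, norm_zeta, Real.exp_lt_one_iff, Complex.add_im, Complex.neg_im]
    have := mul_pos Real.two_pi_pos (sub_pos.2 hz)
    change -(2 * π * (-z.im + τ.im)) < 0
    linarith
  -- Lipschitz's formula, valid because Im z > 0; the sign in (-2πi)^{k+1} disappears since k + 1 is
  -- even.
  have hA : HasSum (fun s : ℕ => (s : ℂ) ^ k * zeta z ^ s)
      (k ! * (((2 * π * Complex.I) ^ (k + 1))⁻¹ * lipschitzSum k z)) := by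
    have h1 := (summable_norm_pow_mul_geometric_of_norm_lt_one k hζ).of_norm.hasSum
    have h2 := EisensteinSeries.qExpansion_identity hk.pos (⟨z, hz0⟩ : ℍ)
    change lipschitzSum k z = _ * ∑' n : ℕ, (n : ℂ) ^ k * zeta z ^ n at h2
    have h3 : (2 * π * Complex.I) ^ (k + 1) ≠ 0 := pow_ne_zero _ Complex.two_pi_I_ne_zero
    have h4 : (k ! : ℂ) ≠ 0 := by exact_mod_cast k.factorial_ne_zero
    have e : (-2 * π * Complex.I) ^ (k + 1) = (2 * π * Complex.I) ^ (k + 1) := by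
      rw [neg_mul, neg_mul, hk.add_one.neg_pow]
    have hv : k ! * (((2 * π * Complex.I) ^ (k + 1))⁻¹ * lipschitzSum k z)
        = ∑' n : ℕ, (n : ℂ) ^ k * zeta z ^ n := by
      rw [h2, e, ← mul_assoc, ← mul_assoc, mul_assoc _ _ (_ / _), ← mul_div_assoc,
        inv_mul_cancel₀ h3, mul_one_div_cancel h4, one_mul]
    rw [hv]
    exact h1
  have hL := (summable_lambertTerm τ hk0 habs).hasSum
  have hq' : 0 < 1 - ‖nome τ‖ := by linarith [norm_nome_lt_one τ]
  have hN : Summable fun s : ℕ => (s : ℂ) ^ k * ((zeta z)⁻¹ * nome τ) ^ s / (1 - nome τ ^ s) := by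
    refine Summable.of_norm_bounded
      ((summable_norm_pow_mul_geometric_of_norm_lt_one k hζq).mul_right (1 - ‖nome τ‖)⁻¹)
      fun s => ?_
    rcases eq_or_ne s 0 with rfl | hs
    · simp [hk0]
    rw [norm_div, div_eq_mul_inv]
    gcongr
    exact one_sub_norm_nome_le τ hs
  -- The ζ^s parts combine through 1 + q^s/(1 - q^s) = 1/(1 - q^s) into the coefficients with r = s
  -- ≥ 0. The ζ^{-s} part, separated off here, gives r = -s < 0, because (-s)^k / (1 - q^{-s}) = s^k
  -- q^s / (1 - q^s) for odd k.
  have hP := (hA.add hL).sub hN.hasSum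
  have hN' := (hasSum_nat_add_iff' 1).2 hN.hasSum
  simp only [Finset.range_one, Finset.sum_singleton, Nat.cast_zero, zero_pow hk0, zero_mul,
    zero_div, sub_zero] at hN'
  have key := HasSum.of_nat_of_neg_add_one
    (f := fun r : ℤ => 1 / (1 - nome τ ^ r) * (r : ℂ) ^ k * zeta z ^ r)
    (hP.congr_fun fun s => ?_) (hN'.congr_fun fun s => ?_)
  · have h4 : (k ! : ℂ) ≠ 0 := by exact_mod_cast k.factorial_ne_zero
    have hval : ellipticSum k τ z = (k ! : ℂ)⁻¹ * (k ! * (((2 * π * Complex.I) ^ (k + 1))⁻¹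
        * lipschitzSum k z) + ∑' s : ℕ, lambertTerm k τ s z) := by
      rw [ellipticSum, mul_add, inv_mul_cancel_left₀ h4]
    rw [sub_add_cancel] at key
    rw [hval]
    refine (key.mul_left (k ! : ℂ)⁻¹).congr_fun fun r => ?_
    ring
  · rcases eq_or_ne s 0 with rfl | hs
    · simp [hk0, lambertTerm]
    have h5 := one_sub_nome_pow_ne_zero τ hs
    simp only [Int.cast_natCast, zpow_natCast, lambertTerm, mul_pow]
    field_simp
    ring
  · have h5 := one_sub_nome_pow_ne_zero τ s.succ_ne_zero
    have h7 := nome_ne_zero τ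
    have h6 : 1 - (nome τ ^ (s + 1))⁻¹ ≠ 0 := by
      rw [sub_ne_zero, ne_comm, inv_ne_one]
      exact fun h => h5 (by rw [Nat.succ_eq_add_one, h, sub_self])
    have h8 := zeta_ne_zero z
    have e : (-((s : ℤ) + 1)) = -((s + 1 : ℕ) : ℤ) := by push_cast; ring
    rw [e]
    simp only [zpow_neg, zpow_natCast, Int.cast_neg, Int.cast_natCast, hk.neg_pow, mul_pow, inv_pow]
    have h9 : nome τ ^ (s + 1) - 1 ≠ 0 := by rwa [← neg_ne_zero, neg_sub]
    field_simp
    ring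

theorem one_sub_nome_zpow_ne_zero {r : ℤ} (hr : r ≠ 0) : 1 - nome τ ^ r ≠ 0 := by
  have h := one_sub_nome_pow_ne_zero τ (Int.natAbs_ne_zero.2 hr)
  rcases Int.natAbs_eq r with e | e <;> rw [e]
  · rwa [zpow_natCast]
  · rw [zpow_neg, zpow_natCast, sub_ne_zero, ne_comm, inv_ne_one]
    exact fun h' => h (by rw [h', sub_self])

/-- Both z + τ and -z lie in 0 < Im < Im τ, where the Fourier series holds. The coefficients c_r
satisfy c_{-r} q^{-r} = c_r, so the values at z + τ and -z agree, and the function is even. -/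
theorem ellipticSum_add_self (hk : Odd k) {z : ℂ} (hz0 : z.im < 0) (hz : -τ.im < z.im) :
    ellipticSum k τ (z + τ) = ellipticSum k τ z := by
  have h1 := hasSum_ellipticSum τ hk (z := -z) (by simpa using hz0) (by simp; linarith)
  have h2 := hasSum_ellipticSum τ hk (z := z + τ) (by simp; linarith) (by simp; linarith)
  rw [ellipticSum_neg τ hk] at h1
  refine ((Equiv.neg ℤ).hasSum_iff.2 h2).unique (h1.congr_fun fun r => ?_)
  by_cases hr : r = 0
  · simp [hr, hk.pos.ne']
  simp only [Function.comp_apply, Equiv.neg_apply, Int.cast_neg, zeta_neg, zeta_add_self,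
    hk.neg_pow, mul_zpow, zpow_neg, inv_zpow]
  have h3 : nome τ ^ r ≠ 0 := zpow_ne_zero _ (nome_ne_zero τ)
  have h4 : 1 - nome τ ^ r ≠ 0 := one_sub_nome_zpow_ne_zero τ hr
  have h5 : 1 - (nome τ ^ r)⁻¹ ≠ 0 := by
    rw [sub_ne_zero, ne_comm, inv_ne_one]
    exact fun h => h4 (by rw [h, sub_self])
  have h6 : nome τ ^ r - 1 ≠ 0 := by rwa [← neg_ne_zero, neg_sub]
  have h7 := zpow_ne_zero r (zeta_ne_zero z)
  field_simp
  ring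

theorem bernoulli_two_mul_ne_zero {j : ℕ} (hj : j ≠ 0) : bernoulli (2 * j) ≠ 0 := by
  intro h
  have h1 := riemannZeta_two_mul_nat hj
  rw [h] at h1
  have h2 : riemannZeta (2 * (j : ℂ)) ≠ 0 := by
    refine riemannZeta_ne_zero_of_one_lt_re ?_
    have : (1 : ℝ) ≤ j := by exact_mod_cast Nat.one_le_iff_ne_zero.2 hj
    simp
    linarith
  exact h2 (by simpa using h1)

/-- The Lipschitz sum contributes 2ζ(2j)/(2πi)^{2j} = -B_{2j}/(2j)! by Euler's formula. The Lambert
series at ζ = 1 contributes 2/(2j-1)! ∑ σ_{2j-1}(l) q^l. Together they are the constant term and the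
q-series of -B_{2j} E_{2j}/(2j)!. -/
theorem tendsto_ellipticSum_sub {j : ℕ} (hj : j ≠ 0) :
    Tendsto (fun z => ellipticSum (2 * j - 1) τ z - 1 / (2 * π * Complex.I * z) ^ (2 * j))
      (𝓝[≠] 0) (𝓝 (-((bernoulli (2 * j) : ℂ) / ((2 * j)! : ℕ) * eisenstein j τ))) := by
  obtain ⟨k, hk2⟩ : ∃ k, 2 * j = k + 1 := Nat.exists_eq_succ_of_ne_zero (by omega)
  have hk : Odd k := by rw [← Nat.not_even_iff_odd, ← Nat.even_add_one, ← hk2]; exact even_two_mul j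
  have hk0 : k ≠ 0 := hk.pos.ne'
  have hB : (bernoulli (2 * j) : ℂ) ≠ 0 := by exact_mod_cast bernoulli_two_mul_ne_zero hj
  have hlam : ∑' s : ℕ, lambertTerm k τ s 0
      = 2 * ∑' l : ℕ, (ArithmeticFunction.sigma k (l + 1) : ℂ) * nome τ ^ (l + 1) := by
    have hs := summable_lambertTerm τ hk0 (z := 0) (by simpa using τ.im_pos)
    have hσ := tsum_pow_div_one_sub_eq_tsum_sigma (norm_nome_lt_one τ) k
    rw [tsum_pnat_eq_tsum_succ (f := fun n : ℕ => (n : ℂ) ^ k * nome τ ^ n / (1 - nome τ ^ n)),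
      tsum_pnat_eq_tsum_succ
        (f := fun n : ℕ => (ArithmeticFunction.sigma k n : ℂ) * nome τ ^ n)] at hσ
    rw [hs.tsum_eq_zero_add, ← hσ, ← tsum_mul_left]
    have h0 : lambertTerm k τ 0 0 = 0 := by simp [lambertTerm, hk0]
    rw [h0, zero_add]
    refine tsum_congr fun s => ?_
    have : zeta 0 = 1 := by simp [zeta]
    rw [lambertTerm, this]
    simp only [one_pow, inv_one]
    ring
  have h1 := (tendsto_lipschitzSum_sub hk).const_mul ((2 * π * Complex.I) ^ (k + 1))⁻¹
  have h2 := ((differentiableAt_tsum_lambertTerm τ hk0 (z := 0)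
    (by simpa using τ.im_pos)).continuousAt.tendsto.mono_left
      (nhdsWithin_le_nhds (s := {0}ᶜ))).const_mul (k ! : ℂ)⁻¹
  have h3 := h1.add h2
  rw [hk2, Nat.add_sub_cancel]
  have hval : ((2 * π * Complex.I) ^ (k + 1))⁻¹ * (2 * riemannZeta ((k + 1 : ℕ) : ℂ))
      + (k ! : ℂ)⁻¹ * ∑' s : ℕ, lambertTerm k τ s 0
      = -((bernoulli (k + 1) : ℂ) / ((k + 1)! : ℕ) * eisenstein j τ) := by
    have hpi : (π : ℂ) ≠ 0 := by exact_mod_cast Real.pi_ne_zero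
    have hf : (k ! : ℂ) ≠ 0 := by exact_mod_cast k.factorial_ne_zero
    have hj' : (j : ℂ) ≠ 0 := by exact_mod_cast hj
    have hk2' : (k : ℂ) + 1 = 2 * j := by exact_mod_cast hk2.symm
    have hI : Complex.I ^ (2 * j) = (-1) ^ j := by rw [pow_mul, Complex.I_sq]
    have hζ := riemannZeta_two_mul_nat hj
    rw [hlam, ← hk2]
    push_cast
    rw [hζ, eisenstein, hk2, Nat.add_sub_cancel, Nat.factorial_succ, ← hk2, mul_pow, mul_pow, hI,
      hk2, pow_succ (2 : ℂ) k]
    push_cast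
    rw [hk2']
    rw [hk2] at hB
    have h1 : ((-1 : ℂ) ^ j) ≠ 0 := pow_ne_zero _ (by norm_num)
    field_simp
    ring
  rw [hval] at h3
  refine h3.congr fun z => ?_
  rw [ellipticSum, mul_pow, one_div, one_div, mul_inv]
  ring

end Elliptic

/-! ### The decomposition of φ and its Fourier coefficients -/

section

variable {m : ℕ} (τ : ℍ)

/-- `φ` is a combination of elliptic functions with a single pole. -/
theorem phi_eq_add_sum_ellipticSum (hm : Even m) {z : ℂ} (hz : |z.im| < τ.im)
    (hzn : ∀ n : ℤ, z ≠ n) : phi m z τ = D m 0 τ + ∑ j ∈ Finset.Icc 1 (m / 2), (bernoulli (2 * j) : ℂ) / ((2 * j)! : ℕ)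
        * D m (2 * j) τ * eisenstein j τ
      + ∑ j ∈ Finset.Icc 1 (m / 2), D m (2 * j) τ * ellipticSum (2 * j - 1) τ z := by
  have hodd : ∀ j ∈ Finset.Icc 1 (m / 2), Odd (2 * j - 1) := by
    intro j hj
    have := (Finset.mem_Icc.1 hj).1
    exact ⟨j - 1, by omega⟩
  rw [← sub_eq_iff_eq_add]
  refine eq_of_periodic_of_tendsto (τ := τ) τ.im_pos (F := fun z => phi m z τ
    - ∑ j ∈ Finset.Icc 1 (m / 2), D m (2 * j) τ * ellipticSum (2 * j - 1) τ z)
    (fun w hw hwn => ?_) (fun w => ?_) (fun w hw hwτ => ?_) ?_ hz hzn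
  · refine (differentiableAt_phi τ hw hwn).sub (DifferentiableAt.fun_sum fun j hj => ?_)
    exact (differentiableAt_ellipticSum τ (hodd j hj).pos.ne' hw hwn).const_mul _
  · simp only [phi_add_one, ellipticSum_add_one]
  · simp only [phi_add_self τ hm]
    congr 1
    refine Finset.sum_congr rfl fun j hj => ?_
    rw [ellipticSum_add_self τ (hodd j hj) hw hwτ]
  · have h1 : Tendsto (fun z : ℂ => phi m z τ - ∑ j ∈ Finset.Icc 0 (m / 2),
        D m (2 * j) τ / (2 * (π : ℂ) * Complex.I * z) ^ (2 * j)) (𝓝[≠] 0) (𝓝 0) := by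
      refine (phiGen_sub_sum_isBigO 0 τ hm).trans_tendsto ?_
      have : Tendsto (fun z : ℂ => z ^ 2) (𝓝 0) (𝓝 (0 ^ 2)) := (continuous_pow 2).tendsto 0
      rw [zero_pow two_ne_zero] at this
      exact this.mono_left nhdsWithin_le_nhds
    have h2 : Tendsto (fun z : ℂ => ∑ j ∈ Finset.Icc 1 (m / 2), D m (2 * j) τ
        * (ellipticSum (2 * j - 1) τ z - 1 / (2 * π * Complex.I * z) ^ (2 * j))) (𝓝[≠] 0)
        (𝓝 (∑ j ∈ Finset.Icc 1 (m / 2), D m (2 * j) τ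
          * -((bernoulli (2 * j) : ℂ) / ((2 * j)! : ℕ) * eisenstein j τ))) :=
      tendsto_finsetSum _ fun j hj => (tendsto_ellipticSum_sub τ
        (by have := (Finset.mem_Icc.1 hj).1; omega)).const_mul _
    have h3 := (h1.add_const (D m 0 τ)).sub h2
    have hv : 0 + D m 0 τ - ∑ j ∈ Finset.Icc 1 (m / 2), D m (2 * j) τ
        * -((bernoulli (2 * j) : ℂ) / ((2 * j)! : ℕ) * eisenstein j τ)
        = D m 0 τ + ∑ j ∈ Finset.Icc 1 (m / 2), (bernoulli (2 * j) : ℂ) / ((2 * j)! : ℕ)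
          * D m (2 * j) τ * eisenstein j τ := by
      rw [zero_add, sub_eq_add_neg, ← Finset.sum_neg_distrib]
      congr 1
      exact Finset.sum_congr rfl fun j _ => by ring
    rw [hv] at h3
    refine h3.congr fun z => ?_
    rw [← Finset.add_sum_Ioc_eq_sum_Icc (Nat.zero_le _)]
    change _ - (_ + ∑ j ∈ Finset.Icc 1 (m / 2), _) + _ - _ = _
    simp only [mul_sub, Finset.sum_sub_distrib, mul_one_div, mul_zero, pow_zero, div_one]
    ring

/-- The Fourier coefficients of `φ` in closed form. -/
noncomputable def fourierCoeff (m : ℕ) (τ : ℍ) (r : ℤ) : ℂ :=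
  (if r = 0 then D m 0 τ + ∑ j ∈ Finset.Icc 1 (m / 2), (bernoulli (2 * j) : ℂ) / ((2 * j)! : ℕ)
        * D m (2 * j) τ * eisenstein j τ else 0)
    + ∑ j ∈ Finset.Icc 1 (m / 2), D m (2 * j) τ
      * (1 / (1 - nome τ ^ r) * ((r : ℂ) ^ (2 * j - 1) / ((2 * j - 1)! : ℕ)))

theorem hasSum_fourierCoeff (hm : Even m) {z : ℂ} (hz0 : 0 < z.im) (hz : z.im < τ.im) :
    HasSum (fun r : ℤ => fourierCoeff m τ r * zeta z ^ r) (phi m z τ) := by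
  rw [phi_eq_add_sum_ellipticSum τ hm (abs_lt.2 ⟨by linarith [τ.im_pos], hz⟩)
    (by rintro n rfl; simp at hz0)]
  have h1 : HasSum (fun r : ℤ => ∑ j ∈ Finset.Icc 1 (m / 2), D m (2 * j) τ
      * (1 / (1 - nome τ ^ r) * ((r : ℂ) ^ (2 * j - 1) / ((2 * j - 1)! : ℕ)) * zeta z ^ r))
      (∑ j ∈ Finset.Icc 1 (m / 2), D m (2 * j) τ * ellipticSum (2 * j - 1) τ z) := by
    refine hasSum_sum fun j hj => (hasSum_ellipticSum τ ?_ hz0 hz).mul_left _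
    have := (Finset.mem_Icc.1 hj).1
    exact ⟨j - 1, by omega⟩
  refine ((hasSum_ite_eq (0 : ℤ) _).add h1).congr_fun fun r => ?_
  rw [fourierCoeff, add_mul, Finset.sum_mul]
  congr 1
  · split_ifs with h <;> simp [h]
  · exact Finset.sum_congr rfl fun j _ => by ring

theorem chi_eq_fourierCoeff (hm : Even m) (r : ℤ) : chi m r τ = fourierCoeff m τ r := by
  refine integral_mul_zeta_zpow_of_hasSum (f := fun z => phi m z τ) (fun x => ?_) r
  have := τ.im_pos
  exact hasSum_fourierCoeff τ hm (by simpa using this) (by simpa using this)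

theorem chi_eq (hm : Even m) {r : ℤ} (hr : r ≠ 0) : chi m r τ = 1 / (1 - nome τ ^ r)
    * ∑ j ∈ Finset.Icc 1 (m / 2),
      (r : ℂ) ^ (2 * j - 1) / (((2 * j - 1)! : ℕ) : ℂ) * D m (2 * j) τ := by
  rw [chi_eq_fourierCoeff τ hm, fourierCoeff, if_neg hr, zero_add, Finset.mul_sum]
  exact Finset.sum_congr rfl fun j _ => by ring

theorem chi_zero (hm : Even m) : chi m 0 τ = D m 0 τ + ∑ j ∈ Finset.Icc 1 (m / 2),
    (bernoulli (2 * j) : ℂ) / (((2 * j)! : ℕ) : ℂ) * D m (2 * j) τ * eisenstein j τ := by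
  rw [chi_eq_fourierCoeff τ hm, fourierCoeff, if_pos rfl]
  -- At r = 0 the second sum of `fourierCoeff` drops out, since 1/(1 - q⁰) is 1/0 = 0.
  simp

theorem hasSum_chi (hm : Even m) {z : ℂ} (hz0 : 0 < z.im) (hz : z.im < τ.im) :
    HasSum (fun r : ℤ => chi m r τ * zeta z ^ r) (phi m z τ) := by
  simp_rw [chi_eq_fourierCoeff τ hm]
  exact hasSum_fourierCoeff τ hm hz0 hz

end

/-! ### Theta functions under T and S -/

section ThetaTransformation

variable (z : ℂ) (τ : ℍ)

/-- exp(πin²) = exp(πin), because n² - n is even. -/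
theorem jacobiTheta₂_add_one_right (z τ : ℂ) :
    jacobiTheta₂ z (τ + 1) = jacobiTheta₂ (z + 1 / 2) τ := by
  refine tsum_congr fun n => ?_
  rw [jacobiTheta₂_term, jacobiTheta₂_term, Complex.exp_eq_exp_iff_exists_int]
  obtain ⟨c, hc⟩ := Int.even_mul_pred_self n
  refine ⟨c, ?_⟩
  have : (n : ℂ) * (n - 1) = c + c := by exact_mod_cast hc
  linear_combination (π * Complex.I) * this

theorem coe_T_smul : ((ModularGroup.T • τ : ℍ) : ℂ) = τ + 1 := by
  rw [UpperHalfPlane.modular_T_smul, UpperHalfPlane.coe_vadd]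
  push_cast; ring

theorem coe_S_smul : ((ModularGroup.S • τ : ℍ) : ℂ) = -1 / τ := by
  rw [UpperHalfPlane.modular_S_smul]
  change (-(τ : ℂ))⁻¹ = _
  rw [inv_neg, neg_div, one_div]

theorem theta_T_smul :
    theta z (ModularGroup.T • τ) = Complex.exp (π * Complex.I / 4) * theta z τ := by
  rw [theta_eq, theta_eq, coe_T_smul, jacobiTheta₂_add_one_right,
    show z + 1 / 2 + ((τ : ℂ) + 1) / 2 + 1 / 2 = z + 1 / 2 + τ / 2 + 1 by ring,
    jacobiTheta₂_add_left, ← mul_assoc, ← Complex.exp_add]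
  congr 2; ring

/-- The automorphy factor of the theta functions under `τ ↦ -1 / τ`. -/
noncomputable def thetaFactor : ℂ :=
  (-Complex.I * τ) ^ (1 / 2 : ℂ) * Complex.exp (π * Complex.I * z ^ 2 / τ)

theorem thetaFactor_ne_zero : thetaFactor z τ ≠ 0 := by
  refine mul_ne_zero ?_ (Complex.exp_ne_zero _)
  rw [Complex.cpow_ne_zero_iff_of_exponent_ne_zero (by norm_num)]
  exact mul_ne_zero (neg_ne_zero.2 Complex.I_ne_zero) (UpperHalfPlane.ne_zero τ)

theorem jacobiTheta₂_div_self :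
    jacobiTheta₂ (z / τ) (-1 / τ) = thetaFactor z τ * jacobiTheta₂ z τ := by
  have h := thetaFactor_ne_zero z τ
  rw [jacobiTheta₂_functional_equation z τ, ← mul_assoc]
  have : thetaFactor z τ * (1 / (-Complex.I * τ) ^ (1 / 2 : ℂ)
      * Complex.exp (-π * Complex.I * z ^ 2 / τ)) = 1 := by
    rw [thetaFactor] at h ⊢
    rw [show (-π * Complex.I * z ^ 2 / τ : ℂ) = -(π * Complex.I * z ^ 2 / τ) by ring,
      Complex.exp_neg]
    rw [mul_mul_mul_comm, mul_one_div_cancel (left_ne_zero_of_mul h),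
      mul_inv_cancel₀ (Complex.exp_ne_zero _), one_mul]
  rw [this, one_mul]

theorem thetaFactor_add (w : ℂ) : thetaFactor (z + w) τ
    = thetaFactor z τ * Complex.exp (π * Complex.I * (2 * z * w + w ^ 2) / τ) := by
  rw [thetaFactor, thetaFactor, mul_assoc (_ ^ _), ← Complex.exp_add]
  congr 2; ring

theorem exp_neg_pi_mul_I_div_two : Complex.exp (-(π * Complex.I / 2)) = -Complex.I := by
  rw [Complex.exp_neg, show (π * Complex.I / 2 : ℂ) = π / 2 * Complex.I by ring,
    Complex.exp_pi_div_two_mul_I, Complex.inv_I]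

/-- A shift by half periods turns ϑ into `jacobiTheta₂`, whose functional equation applies. All the
theta functions acquire the same `thetaFactor`, which therefore cancels in the quotients. -/
theorem theta_S_smul :
    theta (z / τ) (ModularGroup.S • τ) = -Complex.I * thetaFactor z τ * theta z τ := by
  have hτ := UpperHalfPlane.ne_zero τ
  rw [theta_eq, theta_eq, coe_S_smul,
    show z / τ + 1 / 2 + -1 / (τ : ℂ) / 2 = (z + (τ / 2 - 1 / 2)) / τ by field_simp; ring,
    jacobiTheta₂_div_self, ← jacobiTheta₂_add_left (z + (τ / 2 - 1 / 2)), thetaFactor_add,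
    show z + ((τ : ℂ) / 2 - 1 / 2) + 1 = z + 1 / 2 + τ / 2 by ring]
  have : Complex.exp (π * Complex.I * (-1 / τ) / 4 + π * Complex.I * (z / τ + 1 / 2))
      * Complex.exp (π * Complex.I * (2 * z * (τ / 2 - 1 / 2) + (τ / 2 - 1 / 2) ^ 2) / τ)
      = -Complex.I * Complex.exp (π * Complex.I * τ / 4 + π * Complex.I * (z + 1 / 2)) := by
    rw [← exp_neg_pi_mul_I_div_two, ← Complex.exp_add, ← Complex.exp_add]
    congr 1
    field_simp
    ring
  linear_combination thetaFactor z τ * jacobiTheta₂ (z + 1 / 2 + τ / 2) τ * this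

theorem theta_S_smul_add_half : theta (z / τ + 1 / 2) (ModularGroup.S • τ)
    = -thetaFactor z τ * jacobiTheta₂ (z + 1 / 2) τ := by
  have hτ := UpperHalfPlane.ne_zero τ
  rw [theta_add_half, coe_S_smul,
    show z / τ + -1 / (τ : ℂ) / 2 = (z + (-1 / 2)) / τ by field_simp,
    jacobiTheta₂_div_self, ← jacobiTheta₂_add_left (z + (-1 / 2)), thetaFactor_add,
    show z + (-1 / 2) + 1 = z + 1 / 2 by ring]
  have : Complex.exp (π * Complex.I * (-1 / τ) / 4 + π * Complex.I * (z / τ))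
      * Complex.exp (π * Complex.I * (2 * z * (-1 / 2) + (-1 / 2) ^ 2) / τ) = 1 := by
    rw [← Complex.exp_add, Complex.exp_eq_one_iff]
    exact ⟨0, by field_simp; ring⟩
  linear_combination -(thetaFactor z τ * jacobiTheta₂ (z + 1 / 2) τ) * this

theorem jacobiTheta₂_S_smul_add_half : jacobiTheta₂ (z / τ + 1 / 2) (ModularGroup.S • τ : ℍ)
    = -thetaFactor z τ * theta (z + 1 / 2) τ := by
  have hτ := UpperHalfPlane.ne_zero τ
  rw [theta_add_half, coe_S_smul, show z / τ + 1 / 2 = (z + τ / 2) / (τ : ℂ) by field_simp,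
    jacobiTheta₂_div_self, thetaFactor_add]
  have : Complex.exp (π * Complex.I * (2 * z * (τ / 2) + (τ / 2) ^ 2) / τ)
      = Complex.exp (π * Complex.I * τ / 4 + π * Complex.I * z) := by
    congr 1
    field_simp
    ring
  rw [this]
  ring

end ThetaTransformation

/-! ### The action of SL₂(ℤ) on the Laurent coefficients -/

section Slash

variable (m : ℕ) (k : Fin 3) (τ : ℍ)

/-- The permutation of the even theta functions induced by `T`. -/
def permT : Fin 3 → Fin 3
  | 0 => 0
  | 1 => 2
  | 2 => 1

/-- The permutation of the even theta functions induced by `S`. -/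
def permS : Fin 3 → Fin 3
  | 0 => 2
  | 1 => 1
  | 2 => 0

theorem permT_permT : permT (permT k) = k := by fin_cases k <;> rfl

theorem permS_permS : permS (permS k) = k := by fin_cases k <;> rfl

/-- The multiplier of the quotient of theta functions under `T`. -/
noncomputable def multT : Fin 3 → ℂ
  | 0 => 1
  | 1 => Complex.exp (-(π * Complex.I / 4))
  | 2 => Complex.exp (-(π * Complex.I / 4))

/-- The multiplier of the quotient of theta functions under `S`. -/
noncomputable def multS : Fin 3 → ℂ
  | 0 => -Complex.I
  | 1 => Complex.I
  | 2 => -Complex.I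

theorem multT_ne_zero : multT k ≠ 0 := by
  fin_cases k
  · exact one_ne_zero
  · exact Complex.exp_ne_zero _
  · exact Complex.exp_ne_zero _

theorem multS_ne_zero : multS k ≠ 0 := by
  fin_cases k <;> simp [multS]

theorem phiGen_T_smul (z : ℂ) :
    phiGen m k z (ModularGroup.T • τ) = multT k ^ m * phiGen m (permT k) z τ := by
  have h0 := Complex.exp_ne_zero (π * Complex.I / 4)
  rw [phiGen, phiGen, ← mul_pow, theta_T_smul]
  congr 1
  match k with
  | 0 =>
    change theta (z + 1 / 2) (ModularGroup.T • τ) / _ = 1 * (theta (z + 1 / 2) τ / theta z τ)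
    rw [theta_T_smul, mul_div_mul_left _ _ h0, one_mul]
  | 1 =>
    change jacobiTheta₂ z (ModularGroup.T • τ : ℍ) / _
      = Complex.exp (-(π * Complex.I / 4)) * (jacobiTheta₂ (z + 1 / 2) τ / theta z τ)
    rw [coe_T_smul, jacobiTheta₂_add_one_right, Complex.exp_neg, div_mul_eq_div_div_swap]
    ring
  | 2 =>
    change jacobiTheta₂ (z + 1 / 2) (ModularGroup.T • τ : ℍ) / _
      = Complex.exp (-(π * Complex.I / 4)) * (jacobiTheta₂ z τ / theta z τ)
    rw [coe_T_smul, jacobiTheta₂_add_one_right, show z + 1 / 2 + 1 / 2 = z + 1 by ring,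
      jacobiTheta₂_add_left, Complex.exp_neg, div_mul_eq_div_div_swap]
    ring

theorem phiGen_S_smul (z : ℂ) :
    phiGen m k z (ModularGroup.S • τ) = multS k ^ m * phiGen m (permS k) (τ * z) τ := by
  have h0 := thetaFactor_ne_zero (τ * z) τ
  have hz : z = τ * z / τ := (mul_div_cancel_left₀ z (UpperHalfPlane.ne_zero τ)).symm
  have hθ : theta z (ModularGroup.S • τ)
      = thetaFactor (τ * z) τ * (-Complex.I * theta (τ * z) τ) := by
    conv_lhs => rw [hz]
    rw [theta_S_smul]
    ring
  rw [phiGen, phiGen, ← mul_pow, hθ]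
  congr 1
  have hI : ∀ a b : ℂ, a / (-Complex.I * b) = Complex.I * (a / b) := by
    intro a b
    rw [div_mul_eq_div_div, div_neg, Complex.div_I]
    ring
  match k with
  | 0 =>
    change theta (z + 1 / 2) (ModularGroup.S • τ) / _
      = -Complex.I * (jacobiTheta₂ (τ * z + 1 / 2) τ / theta (τ * z) τ)
    conv_lhs => rw [hz]
    rw [theta_S_smul_add_half, ← hz, neg_mul, ← mul_neg, mul_div_mul_left _ _ h0, hI]
    ring
  | 1 =>
    change jacobiTheta₂ z (ModularGroup.S • τ : ℍ) / _
      = Complex.I * (jacobiTheta₂ (τ * z) τ / theta (τ * z) τ)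
    conv_lhs => rw [hz]
    rw [coe_S_smul, jacobiTheta₂_div_self, ← hz, mul_div_mul_left _ _ h0, hI]
  | 2 =>
    change jacobiTheta₂ (z + 1 / 2) (ModularGroup.S • τ : ℍ) / _
      = -Complex.I * (theta (τ * z + 1 / 2) τ / theta (τ * z) τ)
    conv_lhs => rw [hz]
    rw [jacobiTheta₂_S_smul_add_half, ← hz, neg_mul, ← mul_neg, mul_div_mul_left _ _ h0, hI]
    ring

theorem iteratedDeriv_comp_mul_left (i : ℕ) (g : ℂ → ℂ) (a : ℂ) :
    iteratedDeriv i (fun z => g (a * z)) = fun z => a ^ i * iteratedDeriv i g (a * z) := by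
  induction i with
  | zero => simp
  | succ i ih =>
    funext z
    rw [iteratedDeriv_succ, ih, deriv_const_mul_field, deriv_comp_mul_left a (iteratedDeriv i g),
      iteratedDeriv_succ, smul_eq_mul, pow_succ, mul_assoc]

variable {m k τ}

/-- Scaling z by a multiplies the coefficient of z^{-j} by a^{-j}. With a = τ, coming from S, this
is the source of the negative weight. -/
theorem DGen_eq_of_phiGen_eq {k' : Fin 3} {τ' : ℍ} {a c : ℂ} (ha : a ≠ 0) {j : ℕ} (hj : j ≤ m)
    (h : ∀ z, phiGen m k z τ' = c * phiGen m k' (a * z) τ) :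
    DGen m k j τ' = c * (a ^ j)⁻¹ * DGen m k' j τ := by
  obtain ⟨i, rfl⟩ := Nat.exists_eq_add_of_le' hj
  set R := min 1 τ.im / ‖a‖ with hR
  have ha' : 0 < ‖a‖ := norm_pos_iff.2 ha
  have hR0 : 0 < R := div_pos (min_one_im_pos τ) ha'
  have hmem : ∀ z ∈ Metric.ball (0 : ℂ) R, a * z ∈ Metric.ball (0 : ℂ) (min 1 τ.im) := by
    intro z hz
    rw [mem_ball_zero_iff] at hz ⊢
    rwa [norm_mul, mul_comm, ← lt_div_iff₀ ha']
  have hg : DifferentiableOn ℂ (fun z => c * (a ^ (i + j))⁻¹ * phiReg (i + j) k' τ (a * z))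
      (Metric.ball 0 R) :=
    ((differentiableOn_phiReg (i + j) k' τ).comp (f := fun z => a * z) (by fun_prop)
      hmem).const_mul _
  have hf : ∀ z ∈ Metric.ball (0 : ℂ) R, z ≠ 0 → phiGen (i + j) k z τ'
      = c * (a ^ (i + j))⁻¹ * phiReg (i + j) k' τ (a * z) / z ^ (i + j) := by
    intro z _ hz
    rw [h, phiGen_eq _ _ _ (mul_ne_zero ha hz), mul_pow]
    field_simp
  rw [DGen, laurentCoeff_eq_iteratedDeriv (i := i) hR0 hg hf (by push_cast; ring),
    DGen_eq_iteratedDeriv k' τ (i := i) (j := j) rfl, iteratedDeriv_const_mul_field,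
    iteratedDeriv_comp_mul_left, pow_add]
  simp only [mul_zero]
  field_simp

variable {j : ℕ} (k)

theorem DGen_slash_T (hj : 2 * j ≤ m) : DGen m k (2 * j) ∣[-(2 * (j : ℤ))] ModularGroup.T
    = multT k ^ m • DGen m (permT k) (2 * j) := by
  funext τ
  have h : ∀ z, phiGen m k z (ModularGroup.T • τ)
      = multT k ^ m * phiGen m (permT k) (1 * z) τ := fun z => by rw [one_mul, phiGen_T_smul]
  rw [ModularForm.SL_slash_apply, ModularGroup.denom_apply, Pi.smul_apply, smul_eq_mul,
    DGen_eq_of_phiGen_eq one_ne_zero hj h]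
  simp [ModularGroup.coe_T]

theorem DGen_slash_S (hj : 2 * j ≤ m) : DGen m k (2 * j) ∣[-(2 * (j : ℤ))] ModularGroup.S
    = multS k ^ m • DGen m (permS k) (2 * j) := by
  funext τ
  have hτ := UpperHalfPlane.ne_zero τ
  rw [ModularForm.SL_slash_apply, ModularGroup.denom_S, Pi.smul_apply, smul_eq_mul,
    DGen_eq_of_phiGen_eq hτ hj (phiGen_S_smul m k τ), neg_neg,
    show (2 * (j : ℤ)) = ((2 * j : ℕ) : ℤ) by push_cast; rfl, zpow_natCast]
  field_simp

theorem slash_inv_eq {w : ℤ} {f g : ℍ → ℂ} {γ : SL(2, ℤ)} {c : ℂ} (hc : c ≠ 0)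
    (h : f ∣[w] γ = c • g) : g ∣[w] γ⁻¹ = c⁻¹ • f := by
  have h1 : g = c⁻¹ • (f ∣[w] γ) := by rw [h, inv_smul_smul₀ hc]
  rw [h1, ModularForm.SL_smul_slash, ← SlashAction.slash_mul, mul_inv_cancel, SlashAction.slash_one]

/-- The group `SL₂(ℤ)` permutes the Laurent coefficients of the three quotients of theta functions
up to constants. -/
theorem exists_DGen_slash (hj : 2 * j ≤ m) (γ : SL(2, ℤ)) :
    ∀ k, ∃ (c : ℂ) (k' : Fin 3), DGen m k (2 * j) ∣[-(2 * (j : ℤ))] γ = c • DGen m k' (2 * j) := by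
  have hγ : γ ∈ Subgroup.closure {ModularGroup.S, ModularGroup.T} := by
    rw [SpecialLinearGroup.SL2Z_generators]; trivial
  induction hγ using Subgroup.closure_induction'' with
  | mem x hx =>
    intro k
    rcases hx with rfl | rfl
    · exact ⟨_, _, DGen_slash_S k hj⟩
    · exact ⟨_, _, DGen_slash_T k hj⟩
  | inv_mem x hx =>
    intro k
    rcases hx with rfl | rfl
    · have := slash_inv_eq (pow_ne_zero m (multS_ne_zero _)) (DGen_slash_S (permS k) hj)
      rw [permS_permS] at this
      exact ⟨_, _, this⟩
    · have := slash_inv_eq (pow_ne_zero m (multT_ne_zero _)) (DGen_slash_T (permT k) hj)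
      rw [permT_permT] at this
      exact ⟨_, _, this⟩
  | one => exact fun k => ⟨1, k, by rw [SlashAction.slash_one, one_smul]⟩
  | mul x y _ _ hx hy =>
    intro k
    obtain ⟨c, k', h⟩ := hx k
    obtain ⟨c', k'', h'⟩ := hy k'
    exact ⟨c * c', k'', by
      rw [SlashAction.slash_mul, h, ModularForm.SL_smul_slash, h', smul_smul]⟩

end Slash

/-! ### Generators of Γ₀(2) and the character -/

section Gamma0

theorem exists_two_mul_abs_add_mul_le (a : ℤ) {c : ℤ} (hc : c ≠ 0) :
    ∃ n : ℤ, 2 * |a + n * c| ≤ |c| := by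
  have h1 := Int.emod_nonneg a hc
  have h2 := Int.emod_lt_abs a hc
  have h3 := Int.emod_add_mul_ediv a c
  rcases le_or_gt (2 * (a % c)) |c| with h | h
  · refine ⟨-(a / c), ?_⟩
    have : a + -(a / c) * c = a % c := by linarith
    rwa [this, abs_of_nonneg h1]
  · refine ⟨-(a / c) - c.sign, ?_⟩
    have : a + (-(a / c) - c.sign) * c = a % c - |c| := by
      rw [← Int.sign_mul_self_eq_abs]; linarith
    rw [this, abs_of_neg (by linarith)]
    linarith

/-- `Γ₀(2)` is generated by `T`, `S T² S` and `-1`. -/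
theorem Gamma0_two_le {H : Subgroup SL(2, ℤ)} (hT : ModularGroup.T ∈ H)
    (hW : ModularGroup.S * (ModularGroup.T * ModularGroup.T) * ModularGroup.S ∈ H)
    (hneg : (-1 : SL(2, ℤ)) ∈ H) : CongruenceSubgroup.Gamma0 2 ≤ H := by
  set W := ModularGroup.S * (ModularGroup.T * ModularGroup.T) * ModularGroup.S with hWdef
  have hWc : (W : Matrix (Fin 2) (Fin 2) ℤ) = !![-1, 0; 2, -1] := by
    rw [hWdef]; decide
  have hWi : ((W⁻¹ : SL(2, ℤ)) : Matrix (Fin 2) (Fin 2) ℤ) = !![-1, 0; -2, -1] := by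
    rw [hWdef]; decide
  -- Descent on |c|, the absolute value of the lower left entry.
  suffices h : ∀ n : ℕ, ∀ γ : SL(2, ℤ), (γ 1 0).natAbs = n → 2 ∣ γ 1 0 → γ ∈ H by
    intro γ hγ
    rw [CongruenceSubgroup.Gamma0_mem, ZMod.intCast_zmod_eq_zero_iff_dvd] at hγ
    exact h _ γ rfl hγ
  intro n
  induction n using Nat.strong_induction_on with
  | _ n ih =>
  intro γ hn h2
  have hdet := Matrix.SpecialLinearGroup.det_coe γ
  rw [Matrix.det_fin_two] at hdet
  by_cases hc : γ 1 0 = 0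
  · rw [hc, mul_zero, sub_zero] at hdet
    rcases Int.mul_eq_one_iff_eq_one_or_neg_one.1 hdet with ⟨ha, hd⟩ | ⟨ha, hd⟩
    · have : γ = ModularGroup.T ^ (γ 0 1) := by
        ext i j
        rw [ModularGroup.coe_T_zpow]
        fin_cases i <;> fin_cases j <;> simp [ha, hd, hc]
      rw [this]
      exact H.zpow_mem hT _
    · have : γ = -1 * ModularGroup.T ^ (-γ 0 1) := by
        ext i j
        rw [neg_one_mul, Matrix.SpecialLinearGroup.coe_neg, ModularGroup.coe_T_zpow]
        fin_cases i <;> fin_cases j <;> simp [ha, hd, hc]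
      rw [this]
      exact H.mul_mem hneg (H.zpow_mem hT _)
  -- A power of T makes 2|a| ≤ |c|; multiplying by W or W⁻¹ then replaces c by ±2a - c. For one of
  -- the signs the absolute value is |c| - 2|a|, which is smaller than |c| because a ≠ 0: a is odd,
  -- as c is even and the determinant is 1.
  · obtain ⟨r, hr⟩ := exists_two_mul_abs_add_mul_le (γ 0 0) hc
    set δ := ModularGroup.T ^ r * γ with hδ
    have h00 : δ 0 0 = γ 0 0 + r * γ 1 0 := by
      rw [hδ, Matrix.SpecialLinearGroup.coe_mul, ModularGroup.coe_T_zpow]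
      simp [Matrix.mul_apply, Fin.sum_univ_two]
    have h10 : δ 1 0 = γ 1 0 := by
      rw [hδ, Matrix.SpecialLinearGroup.coe_mul, ModularGroup.coe_T_zpow]
      simp [Matrix.mul_apply, Fin.sum_univ_two]
    have hγδ : δ ∈ H → γ ∈ H := fun h => (H.mul_mem_cancel_left (H.zpow_mem hT r)).1 h
    rw [← h00] at hr
    have hne : δ 0 0 ≠ 0 := by
      intro h0
      obtain ⟨c, hc2⟩ := h2
      rw [hc2] at hdet h00
      have : (2 : ℤ) ∣ 1 := ⟨-r * c * γ 1 1 - γ 0 1 * c, by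
        linear_combination (h0 - h00) * γ 1 1 - hdet⟩
      omega
    refine hγδ ?_
    have hW1 : (W * δ) 1 0 = 2 * δ 0 0 - δ 1 0 := by
      rw [Matrix.SpecialLinearGroup.coe_mul, hWc]
      simp [Matrix.mul_apply, Fin.sum_univ_two]
      ring
    have hW2 : (W⁻¹ * δ) 1 0 = -2 * δ 0 0 - δ 1 0 := by
      rw [Matrix.SpecialLinearGroup.coe_mul, hWi]
      simp [Matrix.mul_apply, Fin.sum_univ_two]
      ring
    have hcase : (2 * δ 0 0 - δ 1 0).natAbs < n ∨ (-2 * δ 0 0 - δ 1 0).natAbs < n := by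
      rw [h10, ← hn]
      rw [Int.abs_eq_natAbs, Int.abs_eq_natAbs] at hr
      omega
    rcases hcase with h | h
    · refine (H.mul_mem_cancel_left hW).1 (ih _ h _ (by rw [hW1]) ?_)
      rw [hW1, h10]
      omega
    · refine (H.mul_mem_cancel_left (H.inv_mem hW)).1 (ih _ h _ (by rw [hW2]) ?_)
      rw [hW2, h10]
      omega

variable {m j : ℕ}

theorem DGen_zero_slash_Gamma0 (hm : Even m) (hj : 2 * j ≤ m)
    (γ : CongruenceSubgroup.Gamma0 2) :
    DGen m 0 (2 * j) ∣[-(2 * (j : ℤ))] (γ : SL(2, ℤ)) = psi m hm γ • DGen m 0 (2 * j) := by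
  let H : Subgroup (CongruenceSubgroup.Gamma0 2) :=
    { carrier := {γ | DGen m 0 (2 * j) ∣[-(2 * (j : ℤ))] (γ : SL(2, ℤ))
        = psi m hm γ • DGen m 0 (2 * j)}
      one_mem' := by
        rw [Set.mem_ofPred_eq, OneMemClass.coe_one, SlashAction.slash_one, map_one, one_smul]
      mul_mem' := fun {x y} hx hy => by
        rw [Set.mem_ofPred_eq] at hx hy ⊢
        rw [Subgroup.coe_mul, map_mul, SlashAction.slash_mul, hx, ModularForm.SL_smul_slash, hy,
          smul_smul]
      inv_mem' := fun {x} hx => by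
        rw [Set.mem_ofPred_eq] at hx ⊢
        have h1 : psi m hm x * psi m hm x⁻¹ = 1 := by rw [← map_mul, mul_inv_cancel, map_one]
        rw [Subgroup.coe_inv, slash_inv_eq (left_ne_zero_of_mul_eq_one h1) hx,
          eq_inv_of_mul_eq_one_right h1] }
  suffices h : CongruenceSubgroup.Gamma0 2 ≤ H.map (CongruenceSubgroup.Gamma0 2).subtype by
    obtain ⟨γ', hγ', e⟩ := h γ.2
    rwa [Subtype.ext e] at hγ'
  obtain ⟨n, hn⟩ := hm
  have hT : ModularGroup.T ∈ CongruenceSubgroup.Gamma0 2 := by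
    rw [CongruenceSubgroup.Gamma0_mem]; decide
  have hW : ModularGroup.S * (ModularGroup.T * ModularGroup.T) * ModularGroup.S
      ∈ CongruenceSubgroup.Gamma0 2 := by
    rw [CongruenceSubgroup.Gamma0_mem]; decide
  have hneg : (-1 : SL(2, ℤ)) ∈ CongruenceSubgroup.Gamma0 2 := by
    rw [CongruenceSubgroup.Gamma0_mem]; decide
  refine Gamma0_two_le ⟨⟨_, hT⟩, ?_, rfl⟩ ⟨⟨_, hW⟩, ?_, rfl⟩ ⟨⟨_, hneg⟩, ?_, rfl⟩
  all_goals change _ ∣[_] _ = _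
  · rw [DGen_slash_T 0 hj]
    simp [psi, multT, permT, ModularGroup.coe_T]
  -- Along S, T, T, S the quotients run 0 → 2 → 1 → 2 → 0. The constants multiply to (-i)² e^{-πi/2}
  -- = i, whose power with m = 2n is (-1)ⁿ. This is ψ at c = 2.
  · rw [SlashAction.slash_mul, SlashAction.slash_mul, SlashAction.slash_mul, DGen_slash_S 0 hj,
      ModularForm.SL_smul_slash, ModularForm.SL_smul_slash, ModularForm.SL_smul_slash]
    simp only [permS]
    rw [DGen_slash_T 2 hj, ModularForm.SL_smul_slash, ModularForm.SL_smul_slash]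
    simp only [permT]
    rw [DGen_slash_T 1 hj, ModularForm.SL_smul_slash]
    simp only [permT]
    rw [DGen_slash_S 2 hj]
    simp only [permS, smul_smul, multS, multT, ← mul_pow]
    have e1 : Complex.exp (-(π * Complex.I / 4)) * Complex.exp (-(π * Complex.I / 4))
        = -Complex.I := by
      rw [← exp_neg_pi_mul_I_div_two, ← Complex.exp_add]
      congr 1; ring
    have e2 : (ModularGroup.S * (ModularGroup.T * ModularGroup.T) * ModularGroup.S : SL(2, ℤ)) 1 0
        = 2 := by decide
    have e3 : (m : ℤ) * 2 / 4 = n := by omega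
    change _ = (-1 : ℂ) ^ ((m : ℤ) * (ModularGroup.S * (ModularGroup.T * ModularGroup.T)
      * ModularGroup.S : SL(2, ℤ)) 1 0 / 4) • _
    rw [e2, e3, zpow_natCast, hn, ← two_mul, pow_mul]
    congr 2
    calc _ = (Complex.I * Complex.I * (Complex.exp (-(π * Complex.I / 4))
          * Complex.exp (-(π * Complex.I / 4)))) ^ 2 := by ring
      _ = -1 := by rw [e1, Complex.I_mul_I]; simp
  · have e0 : (-1 : SL(2, ℤ)) 1 0 = 0 := by decide
    change DGen m 0 (2 * j) ∣[-(2 * (j : ℤ))] (-1 : SL(2, ℤ))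
      = (-1 : ℂ) ^ ((m : ℤ) * (-1 : SL(2, ℤ)) 1 0 / 4) • _
    rw [e0, show (-1 : SL(2, ℤ)) = ModularGroup.S * ModularGroup.S by decide,
      SlashAction.slash_mul, DGen_slash_S 0 hj, ModularForm.SL_smul_slash]
    simp only [permS]
    rw [DGen_slash_S 2 hj]
    simp only [permS, smul_smul, multS, ← mul_pow]
    congr 1
    rw [neg_mul_neg, Complex.I_mul_I, hn, ← two_mul, pow_mul]
    simp

end Gamma0

/-! ### Holomorphy in τ -/

section Holomorphic

variable {m : ℕ} {k : Fin 3} {j : ℕ}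

theorem differentiableAt_jacobiTheta₂_comp {f g : ℂ × ℂ → ℂ} {p : ℂ × ℂ}
    (hf : DifferentiableAt ℂ f p) (hg : DifferentiableAt ℂ g p) (h : 0 < (g p).im) :
    DifferentiableAt ℂ (fun p => jacobiTheta₂ (f p) (g p)) p := by
  have h1 := (hasFDerivAt_jacobiTheta₂ (f p) h).differentiableAt
  exact h1.comp p (f := fun p => (f p, g p)) (hf.prodMk hg)

theorem differentiableAt_theta_ofComplex {p : ℂ × ℂ} (hp : 0 < p.1.im) {a : ℂ} :
    DifferentiableAt ℂ (fun p : ℂ × ℂ => theta (p.2 + a) (ofComplex p.1)) p := by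
  have h : (fun p : ℂ × ℂ => theta (p.2 + a) (ofComplex p.1)) =ᶠ[𝓝 p] fun p =>
      Complex.exp (π * Complex.I * p.1 / 4 + π * Complex.I * (p.2 + a + 1 / 2))
        * jacobiTheta₂ (p.2 + a + 1 / 2 + p.1 / 2) p.1 := by
    have : {p : ℂ × ℂ | 0 < p.1.im} ∈ 𝓝 p :=
      (isOpen_lt continuous_const (by fun_prop)).mem_nhds hp
    filter_upwards [this] with w hw
    rw [theta_eq, ofComplex_apply_of_im_pos hw]
  refine DifferentiableAt.congr_of_eventuallyEq ?_ h
  exact DifferentiableAt.mul (by fun_prop)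
    (differentiableAt_jacobiTheta₂_comp (by fun_prop) (by fun_prop) hp)

theorem differentiableAt_thetaEven_ofComplex {p : ℂ × ℂ} (hp : 0 < p.1.im) :
    DifferentiableAt ℂ (fun p : ℂ × ℂ => thetaEven k p.2 (ofComplex p.1)) p := by
  have hJ : ∀ a : ℂ, DifferentiableAt ℂ
      (fun p : ℂ × ℂ => jacobiTheta₂ (p.2 + a) (ofComplex p.1 : ℍ)) p := by
    intro a
    have h : (fun p : ℂ × ℂ => jacobiTheta₂ (p.2 + a) (ofComplex p.1 : ℍ)) =ᶠ[𝓝 p] fun p =>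
        jacobiTheta₂ (p.2 + a) p.1 := by
      have : {p : ℂ × ℂ | 0 < p.1.im} ∈ 𝓝 p :=
        (isOpen_lt continuous_const (by fun_prop)).mem_nhds hp
      filter_upwards [this] with w hw
      rw [ofComplex_apply_of_im_pos hw]
    refine DifferentiableAt.congr_of_eventuallyEq ?_ h
    exact differentiableAt_jacobiTheta₂_comp (by fun_prop) (by fun_prop) hp
  match k with
  | 0 => exact differentiableAt_theta_ofComplex hp
  | 1 =>
    have := hJ 0
    simp only [add_zero] at this
    exact this
  | 2 => exact hJ (1 / 2)

theorem differentiableAt_phiGen_ofComplex {p : ℂ × ℂ} (hp : 0 < p.1.im)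
    (h : theta p.2 (ofComplex p.1) ≠ 0) :
    DifferentiableAt ℂ (fun p : ℂ × ℂ => phiGen m k p.2 (ofComplex p.1)) p := by
  have h1 := differentiableAt_theta_ofComplex hp (a := 0)
  simp only [add_zero] at h1
  have h2 : DifferentiableAt ℂ (fun p : ℂ × ℂ =>
      thetaEven k p.2 (ofComplex p.1) / theta p.2 (ofComplex p.1)) p := by
    simp only [div_eq_mul_inv]
    exact (differentiableAt_thetaEven_ofComplex hp).mul (h1.inv h)
  exact h2.pow m

theorem mdifferentiable_DGen (hj : j ≤ m) : MDifferentiable 𝓘(ℂ) 𝓘(ℂ) (DGen m k j) := by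
  rw [UpperHalfPlane.mdifferentiable_iff]
  intro w₀ hw₀
  have hw₀ : 0 < w₀.im := hw₀
  -- With this ρ, the circle |z| = ρ is admissible for every w with Im w > ρ, an open set containing
  -- w₀. On it the Laurent coefficient is one circle integral whose integrand is jointly
  -- holomorphic.
  set ρ : ℝ := min 1 w₀.im / 2 with hρ
  have hmin : 0 < min 1 w₀.im := lt_min one_pos hw₀
  have hρ0 : 0 < ρ := by positivity
  have hρ1 : ρ < 1 := by have := min_le_left 1 w₀.im; linarith
  have hρw : ρ < w₀.im := by have := min_le_right 1 w₀.im; linarith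
  let U : Set ℂ := {w | ρ < w.im}
  have hU : IsOpen U := isOpen_lt continuous_const Complex.continuous_im
  have him : ∀ w ∈ U, 0 < w.im := fun w hw => hρ0.trans hw
  have hF : ∀ w ∈ U, ∀ z ∈ Metric.sphere (0 : ℂ) ρ, DifferentiableAt ℂ
      (fun p : ℂ × ℂ => phiGen m k p.2 (ofComplex p.1) * (p.2 - 0) ^ (-(-(j : ℤ)) - 1))
      (w, z) := by
    intro w hw z hz
    rw [mem_sphere_zero_iff_norm] at hz
    have hz0 : z ≠ 0 := by rw [← norm_pos_iff, hz]; exact hρ0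
    refine DifferentiableAt.mul (differentiableAt_phiGen_ofComplex (him w hw) ?_) ?_
    · have hmem : z ∈ Metric.ball (0 : ℂ) (min 1 (ofComplex w : ℍ).im) := by
        rw [mem_ball_zero_iff, hz, lt_min_iff]
        refine ⟨hρ1, ?_⟩
        rw [ofComplex_apply_of_im_pos (him w hw)]
        exact hw
      obtain ⟨h1, h2⟩ := abs_im_lt_and_ne_intCast _ hmem hz0
      exact theta_ne_zero h1 h2
    · exact DifferentiableAt.zpow (by fun_prop) (Or.inl (by simpa using hz0))
  have hd := differentiableOn_circleIntegral hU (ρ := ρ)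
    (F := fun w z => phiGen m k z (ofComplex w) * (z - 0) ^ (-(-(j : ℤ)) - 1)) hρ0.le
    (fun p hp => (hF p.1 hp.1 p.2 hp.2).continuousAt.continuousWithinAt)
    (fun z hz w hw => ((hF w hw z hz).comp w (f := fun w => (w, z))
      (by fun_prop)).differentiableWithinAt)
  have hd' := ((hd.const_mul (2 * π * Complex.I)⁻¹).const_mul
    ((2 * π * Complex.I) ^ j)).differentiableAt (hU.mem_nhds hρw)
  refine (hd'.congr_of_eventuallyEq ?_).differentiableWithinAt
  filter_upwards [hU.mem_nhds hρw] with w hw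
  refine DGen_eq_circleIntegral k _ hj hρ0 (lt_min hρ1 ?_)
  rw [ofComplex_apply_of_im_pos (him w hw)]
  exact hw

end Holomorphic

/-! ### Growth at the cusps -/

section Cusp

/-- A summable bound for the terms of the theta functions. -/
noncomputable def thetaBound (n : ℤ) : ℝ := Real.exp (-π * (1 * n ^ 2 - 2 * (3 / 4) * |n|))

theorem summable_thetaBound : Summable thetaBound := by
  refine (summable_pow_mul_jacobiTheta₂_term_bound (3 / 4) one_pos 0).congr fun n => ?_
  rw [pow_zero, one_mul, thetaBound]

theorem norm_jacobiTheta₂_le {z τ : ℂ} (hz : |z.im| ≤ 3 / 4) (hτ : 1 ≤ τ.im) :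
    ‖jacobiTheta₂ z τ‖ ≤ ∑' n, thetaBound n :=
  tsum_of_norm_bounded summable_thetaBound.hasSum fun n =>
    norm_jacobiTheta₂_term_le one_pos hz hτ n

/-- The shift by τ/2 turns n² Im τ into (n² + n) Im τ. The part of this belonging to Im τ - 1 gives
the decay. At Im τ = 1 the shift and z together contribute at most (1/2 + 1/4)·2|n|, hence the 3/4
in `thetaBound`. -/
theorem norm_jacobiTheta₂_term_add_half_le {z τ : ℂ} {c : ℝ} (hz : |z.im| ≤ 1 / 4) (hτ : 1 ≤ τ.im)
    (n : ℤ) (hc : c ≤ (n : ℝ) ^ 2 + n) : ‖jacobiTheta₂_term n (z + τ / 2) τ‖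
      ≤ Real.exp (-π * c * (τ.im - 1)) * thetaBound n := by
  rw [norm_jacobiTheta₂_term, thetaBound, ← Real.exp_add, Real.exp_le_exp]
  have e : (z + τ / 2).im = z.im + τ.im / 2 := by simp
  rw [e]
  have h1 : -(n * z.im) ≤ |(n : ℝ)| * (1 / 4) := by
    refine (neg_le_abs _).trans ?_
    rw [abs_mul]
    gcongr
  have h2 : -(n : ℝ) ≤ |(n : ℝ)| := neg_le_abs _
  have h3 : c * (τ.im - 1) ≤ ((n : ℝ) ^ 2 + n) * (τ.im - 1) :=
    mul_le_mul_of_nonneg_right hc (by linarith)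
  have h4 : (n : ℝ) ^ 2 - 3 / 2 * |(n : ℝ)| + c * (τ.im - 1)
      ≤ (n : ℝ) ^ 2 * τ.im + 2 * n * (z.im + τ.im / 2) := by
    nlinarith
  have := mul_le_mul_of_nonneg_left h4 Real.pi_pos.le
  push_cast
  nlinarith

theorem intCast_sq_add_nonneg (n : ℤ) : (0 : ℝ) ≤ (n : ℝ) ^ 2 + n := by
  have : 0 ≤ n ^ 2 + n := by
    rcases le_or_gt 0 n with h | h
    · positivity
    · have : n ≤ -1 := by omega
      nlinarith
  exact_mod_cast this

theorem two_le_intCast_sq_add {n : ℤ} (h0 : n ≠ 0) (h1 : n ≠ -1) : (2 : ℝ) ≤ (n : ℝ) ^ 2 + n := by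
  have : 2 ≤ n ^ 2 + n := by
    rcases lt_or_gt_of_ne h0 with h | h
    · have : n ≤ -2 := by omega
      nlinarith
    · nlinarith
  exact_mod_cast this

theorem norm_jacobiTheta₂_add_half_le {z τ : ℂ} (hz : |z.im| ≤ 1 / 4) (hτ : 1 ≤ τ.im) :
    ‖jacobiTheta₂ (z + τ / 2) τ‖ ≤ ∑' n, thetaBound n := by
  refine tsum_of_norm_bounded summable_thetaBound.hasSum fun n => ?_
  have := norm_jacobiTheta₂_term_add_half_le hz hτ n (intCast_sq_add_nonneg n)
  simpa using this

theorem norm_exp_pi_mul (z τ : ℂ) : ‖Complex.exp (π * Complex.I * τ / 4 + π * Complex.I * z)‖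
    = Real.exp (-(π * τ.im / 4) - π * z.im) := by
  rw [Complex.norm_exp]
  congr 1
  have : (π * Complex.I * τ / 4 : ℂ) = (π / 4 : ℝ) * (Complex.I * τ) := by push_cast; ring
  rw [this, mul_assoc, Complex.add_re, Complex.re_ofReal_mul, Complex.re_ofReal_mul]
  simp
  ring

theorem norm_thetaEven_le (k : Fin 3) {z : ℂ} {τ : ℍ} (hz : |z.im| ≤ 1 / 4) (hτ : 1 ≤ τ.im) :
    ‖thetaEven k z τ‖ ≤ Real.exp π * ∑' n, thetaBound n := by
  have hB : 0 ≤ ∑' n, thetaBound n := tsum_nonneg fun n => (Real.exp_pos _).le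
  have h1 : ∑' n, thetaBound n ≤ Real.exp π * ∑' n, thetaBound n :=
    le_mul_of_one_le_left hB (Real.one_le_exp Real.pi_pos.le)
  have hz' : |z.im| ≤ 3 / 4 := hz.trans (by norm_num)
  match k with
  | 0 =>
    change ‖theta (z + 1 / 2) τ‖ ≤ _
    rw [theta_add_half, norm_mul, norm_neg, norm_exp_pi_mul]
    refine mul_le_mul ?_ (norm_jacobiTheta₂_add_half_le hz hτ) (norm_nonneg _) (Real.exp_pos _).le
    rw [Real.exp_le_exp]
    have := (abs_le.1 hz).1
    have h3 : (τ : ℂ).im = τ.im := rfl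
    rw [h3]
    nlinarith [Real.pi_pos, mul_pos Real.pi_pos τ.im_pos]
  | 1 => exact (norm_jacobiTheta₂_le hz' hτ).trans h1
  | 2 =>
    refine (norm_jacobiTheta₂_le ?_ hτ).trans h1
    simpa using hz'

/-- The terms n = 0 and n = -1, where n² + n = 0, add up to 1 - ζ⁻¹. All others have n² + n ≥ 2 and
are exponentially small in Im τ. -/
theorem norm_jacobiTheta₂_add_half_ge {z τ : ℂ} (hz : |z.im| ≤ 1 / 4) (hτ : 1 ≤ τ.im) :
    ‖1 - (zeta z)⁻¹‖ - Real.exp (-(2 * π) * (τ.im - 1)) * ∑' n, thetaBound n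
      ≤ ‖jacobiTheta₂ (z + 1 / 2 + τ / 2) τ‖ := by
  have hτ0 : 0 < τ.im := by linarith
  have hz' : |(z + 1 / 2).im| ≤ 1 / 4 := by simpa using hz
  have h1 := hasSum_jacobiTheta₂_term (z + 1 / 2 + τ / 2) hτ0
  have h2 := hasSum_sum_of_ne_finset_zero (L := .unconditional ℤ) (s := {0, -1})
    (f := fun n : ℤ => if n = 0 ∨ n = -1 then jacobiTheta₂_term n (z + 1 / 2 + τ / 2) τ else 0)
    (fun n hn => if_neg (by simpa using hn))
  have hs : ∑ n ∈ ({0, -1} : Finset ℤ),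
      (if n = 0 ∨ n = -1 then jacobiTheta₂_term n (z + 1 / 2 + τ / 2) τ else 0)
      = 1 - (zeta z)⁻¹ := by
    rw [Finset.sum_pair (by norm_num)]
    simp only [true_or, or_true, if_true, jacobiTheta₂_term, zeta]
    rw [← Complex.exp_neg, sub_eq_add_neg]
    congr 1
    · simp
    · rw [show (2 * π * Complex.I * ((-1 : ℤ) : ℂ) * (z + 1 / 2 + τ / 2)
        + π * Complex.I * ((-1 : ℤ) : ℂ) ^ 2 * τ : ℂ)
        = -(2 * π * Complex.I * z) + -(π * Complex.I) by push_cast; ring,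
        Complex.exp_add _ (-(π * Complex.I)), Complex.exp_neg (π * Complex.I),
        Complex.exp_pi_mul_I, inv_neg, inv_one]
      ring
  rw [hs] at h2
  have h3 : ‖jacobiTheta₂ (z + 1 / 2 + τ / 2) τ - (1 - (zeta z)⁻¹)‖
      ≤ Real.exp (-(2 * π) * (τ.im - 1)) * ∑' n, thetaBound n := by
    rw [← (h1.sub h2).tsum_eq]
    refine tsum_of_norm_bounded (summable_thetaBound.hasSum.mul_left _) fun n => ?_
    by_cases hn : n = 0 ∨ n = -1
    · rw [if_pos hn, sub_self, norm_zero]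
      exact mul_nonneg (Real.exp_pos _).le (Real.exp_pos _).le
    · rw [if_neg hn, sub_zero]
      push Not at hn
      have := norm_jacobiTheta₂_term_add_half_le hz' hτ n (two_le_intCast_sq_add hn.1 hn.2)
      rwa [show -π * 2 * (τ.im - 1) = -(2 * π) * (τ.im - 1) by ring] at this
  have h4 := norm_sub_norm_le (1 - (zeta z)⁻¹) (jacobiTheta₂ (z + 1 / 2 + τ / 2) τ)
  rw [norm_sub_rev (1 - _)] at h4
  linarith

/-- By compactness |1 - ζ⁻¹| ≥ d > 0 on the circle, and for large Im τ the remaining terms stay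
below d/2. The prefactor of ϑ supplies e^{-π Im τ/4}; e^{-π} absorbs its dependence on z. -/
theorem exists_norm_theta_ge : ∃ c > 0, ∃ A : ℝ, 1 ≤ A ∧ ∀ (τ : ℍ), A ≤ τ.im →
    ∀ z ∈ Metric.sphere (0 : ℂ) (1 / 4), c * Real.exp (-(π * τ.im / 4)) ≤ ‖theta z τ‖ := by
  have hcont : Continuous fun z : ℂ => ‖1 - (zeta z)⁻¹‖ := by
    have h1 : Continuous zeta := by unfold zeta; fun_prop
    exact (continuous_const.sub (h1.inv₀ zeta_ne_zero)).norm
  obtain ⟨w, hw, hmin⟩ := (isCompact_sphere (0 : ℂ) (1 / 4)).exists_isMinOn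
    (NormedSpace.sphere_nonempty.2 (by norm_num)) hcont.continuousOn
  set d := ‖1 - (zeta w)⁻¹‖ with hd
  have hd0 : 0 < d := by
    rw [mem_sphere_zero_iff_norm] at hw
    have h0 : w ≠ 0 := by rw [← norm_pos_iff, hw]; norm_num
    have hne : ∀ n : ℤ, w ≠ n := by
      have : w ∈ Metric.ball (0 : ℂ) (min 1 UpperHalfPlane.I.im) := by
        rw [mem_ball_zero_iff, hw]
        norm_num
      exact (abs_im_lt_and_ne_intCast _ this h0).2
    rw [hd, norm_pos_iff, sub_ne_zero, ne_comm, Ne, inv_eq_one]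
    exact fun h => one_sub_zeta_ne_zero hne (by rw [h, sub_self])
  have hlim : Tendsto (fun y : ℝ => Real.exp (-(2 * π) * (y - 1)) * ∑' n, thetaBound n) atTop
      (𝓝 0) := by
    rw [← zero_mul (∑' n, thetaBound n)]
    refine Tendsto.mul_const _ (Real.tendsto_exp_atBot.comp ?_)
    refine Tendsto.const_mul_atTop_of_neg (by linarith [Real.pi_pos]) ?_
    exact tendsto_atTop_add_const_right _ _ tendsto_id
  obtain ⟨A, hA⟩ := eventually_atTop.1 (hlim.eventually (gt_mem_nhds (half_pos hd0)))
  refine ⟨Real.exp (-π) * (d / 2), by positivity, max 1 A, le_max_left _ _, fun τ hτ z hz => ?_⟩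
  have hzim : |z.im| ≤ 1 / 4 := by
    rw [mem_sphere_zero_iff_norm] at hz
    exact (Complex.abs_im_le_norm z).trans hz.le
  have h1 := norm_jacobiTheta₂_add_half_ge hzim (τ := τ) ((le_max_left _ _).trans hτ)
  have h2 := hA τ.im ((le_max_right _ _).trans hτ)
  have h3 : d ≤ ‖1 - (zeta z)⁻¹‖ := hmin hz
  have h4 : d / 2 ≤ ‖jacobiTheta₂ (z + 1 / 2 + τ / 2) τ‖ := by
    change Real.exp (-(2 * π) * ((τ : ℂ).im - 1)) * _ < _ at h2
    linarith
  rw [theta_eq, norm_mul, norm_exp_pi_mul]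
  have h5 : Real.exp (-π) * Real.exp (-(π * τ.im / 4))
      ≤ Real.exp (-(π * (τ : ℂ).im / 4) - π * (z + 1 / 2).im) := by
    rw [← Real.exp_add, Real.exp_le_exp]
    have h6 : (τ : ℂ).im = τ.im := rfl
    have h7 : (z + 1 / 2).im = z.im := by simp
    rw [h6, h7]
    nlinarith [Real.pi_pos, (abs_le.1 hzim).2]
  calc Real.exp (-π) * (d / 2) * Real.exp (-(π * τ.im / 4))
      = Real.exp (-π) * Real.exp (-(π * τ.im / 4)) * (d / 2) := by ring
    _ ≤ _ := by gcongr

/-- On |z| = 1/4 the even theta functions are bounded and ϑ is at least c e^{-π Im τ/4}. The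
quotient thus grows at most like e^{π Im τ/4}, which one factor q absorbs. -/
theorem isBoundedAtImInfty_nome_pow_mul_DGen {m : ℕ} (k : Fin 3) {j : ℕ} (hj : j ≤ m) :
    IsBoundedAtImInfty fun τ : ℍ => nome τ ^ m * DGen m k j τ := by
  obtain ⟨c, hc, A, hA1, hA⟩ := exists_norm_theta_ge
  set B := Real.exp π * ∑' n, thetaBound n with hB
  have hB0 : 0 ≤ B := mul_nonneg (Real.exp_pos _).le (tsum_nonneg fun n => (Real.exp_pos _).le)
  rw [UpperHalfPlane.isBoundedAtImInfty_iff]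
  refine ⟨‖(2 * π * Complex.I : ℂ) ^ j‖ * (‖(2 * π * Complex.I : ℂ)⁻¹‖
    * (2 * π * (1 / 4) * ((B / c) ^ m * (1 / 4 : ℝ) ^ (-(-(j : ℤ)) - 1)))), max 1 A, fun τ hτ => ?_⟩
  have hτ1 : 1 ≤ τ.im := (le_max_left _ _).trans hτ
  have hτA : A ≤ τ.im := (le_max_right _ _).trans hτ
  rw [DGen_eq_circleIntegral k τ hj (ρ := 1 / 4) (by norm_num)
    (lt_min (by norm_num) (by linarith)), mul_left_comm, mul_left_comm (nome τ ^ m),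
    ← circleIntegral.integral_const_mul, norm_mul, norm_mul]
  gcongr
  refine circleIntegral.norm_integral_le_of_norm_le_const (by norm_num) fun z hz => ?_
  have hzn := mem_sphere_zero_iff_norm.1 hz
  have hzim : |z.im| ≤ 1 / 4 := (Complex.abs_im_le_norm z).trans hzn.le
  rw [norm_mul, norm_mul, norm_zpow, sub_zero, hzn, ← mul_assoc]
  gcongr
  rw [phiGen, ← norm_mul, ← mul_pow, norm_pow]
  gcongr
  have h1 := hA τ hτA z hz
  have h2 := norm_thetaEven_le k hzim hτ1
  have h3 : ‖nome τ‖ ≤ Real.exp (-(π * τ.im / 4)) := by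
    have e : nome τ = zeta τ := rfl
    rw [e, norm_zeta, Real.exp_le_exp]
    change -(2 * π * τ.im) ≤ _
    nlinarith [mul_pos Real.pi_pos τ.im_pos]
  have h4 : 0 < c * Real.exp (-(π * τ.im / 4)) := by positivity
  rw [norm_mul, norm_div]
  calc ‖nome τ‖ * (‖thetaEven k z τ‖ / ‖theta z τ‖)
      ≤ Real.exp (-(π * τ.im / 4)) * (B / (c * Real.exp (-(π * τ.im / 4)))) := by gcongr
    _ = B / c := by
      have := (Real.exp_pos (-(π * τ.im / 4))).ne'
      field_simp

theorem isWeaklyHolomorphicModularForm_D {m : ℕ} (hm : Even m) {j : ℕ} (hj : 2 * j ≤ m) :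
    IsWeaklyHolomorphicModularForm 2 (-(2 * (j : ℤ))) (psi m hm) (D m (2 * j)) where
  holomorphic := mdifferentiable_DGen (k := 0) hj
  slash_eq γ τ := congrFun (DGen_zero_slash_Gamma0 hm hj γ) τ
  meromorphic_at_cusps γ := by
    -- At any cusp the slashed function is a constant multiple of a coefficient of one of the three
    -- quotients, so the bound at i∞ suffices.
    obtain ⟨c, k, h⟩ := exists_DGen_slash hj γ 0
    rw [DGen_zero] at h
    refine ⟨m, ?_⟩
    have h1 : IsBoundedAtImInfty fun τ : ℍ => c * (nome τ ^ m * DGen m k (2 * j) τ) :=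
      Asymptotics.IsBigO.const_mul_left (isBoundedAtImInfty_nome_pow_mul_DGen k hj) c
    convert h1 using 2 with τ
    rw [h, Pi.smul_apply, smul_eq_mul]
    ring

end Cusp

end KacWakimoto

/-! ### The main theorem -/

theorem theorem1p1 (m : ℕ) (hm : Even m) (hm0 : 0 < m) :
    -- the Laurent expansion of `φ` at `z = 0`, which defines the functions `D_{2j}`
    (∀ τ : ℍ,
      (fun z : ℂ => KacWakimoto.phi m z τ
        - ∑ j ∈ Finset.Icc 0 (m / 2),
            KacWakimoto.D m (2 * j) τ / (2 * (π : ℂ) * Complex.I * z) ^ (2 * j))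
        =O[𝓝[≠] (0 : ℂ)] fun z : ℂ => z ^ 2) ∧
    -- the Fourier expansion of `φ` in `0 < Im z < Im τ`, which defines the functions `χ_r`
    (∀ (τ : ℍ) (z : ℂ), 0 < z.im → z.im < τ.im →
      HasSum (fun r : ℤ => KacWakimoto.chi m r τ * KacWakimoto.zeta z ^ r)
        (KacWakimoto.phi m z τ)) ∧
    -- the formula for `χ_r`, `r ≠ 0`
    (∀ (τ : ℍ) (r : ℤ), r ≠ 0 →
      KacWakimoto.chi m r τ =
        1 / (1 - KacWakimoto.nome τ ^ r)
          * ∑ j ∈ Finset.Icc 1 (m / 2),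
              (r : ℂ) ^ (2 * j - 1) / (((2 * j - 1)! : ℕ) : ℂ) * KacWakimoto.D m (2 * j) τ) ∧
    -- the formula for `χ_0`
    (∀ τ : ℍ,
      KacWakimoto.chi m 0 τ =
        KacWakimoto.D m 0 τ
          + ∑ j ∈ Finset.Icc 1 (m / 2),
              (bernoulli (2 * j) : ℂ) / (((2 * j)! : ℕ) : ℂ)
                * KacWakimoto.D m (2 * j) τ * KacWakimoto.eisenstein j τ) ∧
    -- modularity of the functions `D_{2j}`
    (∀ j : ℕ, j ≤ m / 2 →
      KacWakimoto.IsWeaklyHolomorphicModularForm 2 (-(2 * (j : ℤ))) (KacWakimoto.psi m hm)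
        (KacWakimoto.D m (2 * j))) :=
  ⟨fun τ => KacWakimoto.phiGen_sub_sum_isBigO 0 τ hm,
    fun τ _ h0 h => KacWakimoto.hasSum_chi τ hm h0 h,
    fun τ _ hr => KacWakimoto.chi_eq τ hm hr,
    fun τ => KacWakimoto.chi_zero τ hm,
    fun j hj => KacWakimoto.isWeaklyHolomorphicModularForm_D hm (by omega)⟩
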